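/- Let $M$ be a smooth connected manifold of dimension $n$ endowed with a smooth Riemannian metric, and let $d$ be the associated Riemannian distance. Let $S^1=\mathbb{R}/2\pi\mathbb{Z}$ and let $G_1,\dots,G_m$ be smooth vector fields on $M$ depending on an angle, $G_i\in C^\infty(S^1\times M,TM)$ with $G_i(\theta,x)\in T_xM$ (equivalently, $2\pi$-periodic in $\theta\in\mathbb{R}$). For $u\in\mathbb{R}^m$ write $G(\theta,x)u=\sum_{i=1}^m u_iG_i(\theta,x)$, let $\|\cdot\|$ be the Euclidean norm on $\mathbb{R}^m$, and let $B^m$ be its closed unit ball. Fix $T>0$. For $\varepsilon>0$ and a measurable control $u(\cdot):[0,T]\to\mathbb{R}^m$ with $\|u(t)\|\le 1$ for almost all $t$, a solution on $[0,T]$ of the fast-oscillating system $$\dot x=G(t/\varepsilon,x)\,u(t)\qquad(\mathrm{O}_\varepsilon)$$ is an absolutely continuous $x(\cdot):[0,T]\to M$ satisfying the equation for almost all $t\in[0,T]$. For $x\in M$ put $$E(x)=\Big\{\tfrac1{2\pi}\int_0^{2\pi}G(\theta,x)\,U(\theta)\,d\theta\ :\ U\in L^\infty([0,2\pi],\mathbb{R}^m),\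 \|U\|_\infty\le 1\Big\}\subset T_xM .$$ A solution on $[0,T]$ of the average differential inclusion $\dot x\in E(x)$ is an absolutely continuous $x(\cdot):[0,T]\to M$ such that $\dot x(t)\in E(x(t))$ for almost all $t\in[0,T]$. 1. Let $x_0(\cdot):[0,T]\to M$ be an arbitrary solution of $\dot x\in E(x)$. There exist a family of measurable functions $\overline u_\varepsilon(\cdot):[0,T]\to B^m$, indexed by $\varepsilon>0$, and constants $c>0$, $\varepsilon_0>0$ such that, for all $\varepsilon$ with $0<\varepsilon<\varepsilon_0$, the system $(\mathrm{O}_\varepsilon)$ with control $u=\overline u_\varepsilon$ and initial condition $x_\varepsilon(0)=x_0(0)$ has a unique solution $x_\varepsilon(\cdot)$ on $[0,T]$, and $$d(x_\varepsilon(t),x_0(t))<c\,\varepsilon\qquad\text{for all } t\in[0,T].$$ 2. Let $K\subset M$ be compact, $(\varepsilon_k)_{k\in\mathbb{N}}$ a decreasing sequence of positive real numbers converging to zero and, for each $k$, let $x_k(\cdot):[0,T]\to K$ be a solution of $(\mathrm{O}_{\varepsilon_k})$ for some control $u=u_k(t)$, $u_k\in L^\infty([0,T],\mathbb{R}^m)$,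 $\|u_k\|_\infty\le1$. Then the sequence $(x_k(\cdot))_{k\in\mathbb{N}}$ is relatively compact in $C^0([0,T],M)$ for the topology of uniform convergence on $[0,T]$, and any accumulation point of it is a solution on $[0,T]$ of the average differential inclusion $\dot x\in E(x)$. -/

import Mathlib

open Set Filter Topology MeasureTheory Manifold Bundle
open scoped ContDiff

noncomputable section

/-- The data of a fast-oscillating control system on an `n`-dimensional manifold `M`: vector fields
`G₁, …, G_m` on `M` depending on an angle `θ ∈ S¹ = ℝ/2πℤ`, jointly smooth in `(θ, x)`.
Maps on `S¹` are identified with `2π`-periodic maps on `ℝ`. -/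
structure OscillatingFields (m n : ℕ) (M : Type*) [TopologicalSpace M]
    [ChartedSpace (EuclideanSpace ℝ (Fin n)) M] [IsManifold (𝓡 n) ∞ M] where
  /-- `field i θ x` is the vector `G_i(θ, x) ∈ T_x M`. -/
  field : Fin m → ℝ → (x : M) → TangentSpace (𝓡 n) x
  periodic : ∀ i θ x, field i (θ + 2 * Real.pi) x = field i θ x
  smooth : ∀ i, ContMDiff (𝓘(ℝ, ℝ).prod (𝓡 n)) (𝓡 n).tangent ∞
    (fun p : ℝ × M => (⟨p.2, field i p.1 p.2⟩ : TangentBundle (𝓡 n) M))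

namespace OscillatingFields

variable {m n : ℕ} {M : Type*}

section Velocity

variable [TopologicalSpace M] [ChartedSpace (EuclideanSpace ℝ (Fin n)) M] [IsManifold (𝓡 n) ∞ M]

/-- The vector `G(θ, x) u = ∑ᵢ uᵢ G_i(θ, x)` of `T_x M`. -/
def apply (G : OscillatingFields m n M) (θ : ℝ) (x : M) (u : EuclideanSpace ℝ (Fin m)) :
    TangentSpace (𝓡 n) x :=
  ∑ i, u i • G.field i θ x

/-- The averaged vector `Ḡ(x, U) = (1/2π) ∫₀^{2π} G(θ, x) U(θ) dθ` of `T_x M`, the integral being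
taken in the fixed finite-dimensional vector space `T_x M` (in Mathlib a copy of `ℝⁿ`). -/
def average (G : OscillatingFields m n M) (x : M) (U : ℝ → EuclideanSpace ℝ (Fin m)) :
    TangentSpace (𝓡 n) x :=
  let f : ℝ → EuclideanSpace ℝ (Fin n) := fun θ => G.apply θ x (U θ)
  ((2 * Real.pi)⁻¹ • ∫ θ in (0 : ℝ)..(2 * Real.pi), f θ : EuclideanSpace ℝ (Fin n))

/-- The velocity set `E(x) ⊆ T_x M` of the average system: all averages `Ḡ(x, U)` with `U` in the
unit ball of `L^∞([0, 2π], ℝᵐ)`. -/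
def velocitySet (G : OscillatingFields m n M) (x : M) : Set (TangentSpace (𝓡 n) x) :=
  {v | ∃ U : ℝ → EuclideanSpace ℝ (Fin m),
    AEStronglyMeasurable U (volume.restrict (Icc 0 (2 * Real.pi))) ∧
    (∀ᵐ θ ∂volume.restrict (Icc 0 (2 * Real.pi)), ‖U θ‖ ≤ 1) ∧
    v = G.average x U}

end Velocity

section Solutions

variable [MetricSpace M] [ChartedSpace (EuclideanSpace ℝ (Fin n)) M] [IsManifold (𝓡 n) ∞ M]

/-- `x` is on `[0, T]` a solution of `ẋ = G(t/ε, x) u(t)`: it is absolutely continuous on `[0, T]`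
(for the distance of `M`; for a Riemannian distance this agrees with absolute continuity in
charts), and the equation holds for almost all `t ∈ [0, T]`. -/
def IsSolution (G : OscillatingFields m n M) (ε T : ℝ) (u : ℝ → EuclideanSpace ℝ (Fin m))
    (x : ℝ → M) : Prop :=
  AbsolutelyContinuousOnInterval x 0 T ∧
  ∀ᵐ t ∂volume.restrict (Icc 0 T),
    HasMFDerivWithinAt 𝓘(ℝ, ℝ) (𝓡 n) x (Icc 0 T) t
      ((1 : ℝ →L[ℝ] ℝ).smulRight (G.apply (t / ε) (x t) (u t)))

/-- `x` is on `[0, T]` a solution of the average differential inclusion `ẋ ∈ E(x)`: it is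
absolutely continuous and `ẋ(t) ∈ E(x(t))` for almost all `t ∈ [0, T]`. -/
def IsAverageSolution (G : OscillatingFields m n M) (T : ℝ) (x : ℝ → M) : Prop :=
  AbsolutelyContinuousOnInterval x 0 T ∧
  ∀ᵐ t ∂volume.restrict (Icc 0 T), ∃ v ∈ G.velocitySet (x t),
    HasMFDerivWithinAt 𝓘(ℝ, ℝ) (𝓡 n) x (Icc 0 T) t ((1 : ℝ →L[ℝ] ℝ).smulRight v)

end Solutions

end OscillatingFields

end

/-!
Over one fast period, of length `2πε`, the state of the oscillating system hardly moves, so that the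
displacement produced by a control `u` is, up to an error of order `ε²`, the vector `2πε` times a
mean `(1/2π) ∫ G(θ, x) U(θ) dθ` with frozen `x`, and every such mean is produced by some control.
These means form a closed convex set `periodMeans`: convexity is immediate, and closedness
(`isClosed_periodMeans`) holds because the admissible `U` form a closed bounded convex set of the
Hilbert space `L²`. Both parts of the theorem follow.

For the approximation of an average trajectory in a chart, its displacement over a fast period is an
average of velocities that lie within `O(ε)` of the convex set of means at the initial point of the
period, hence so does the mean velocity over the period
(`IsOscillatingField.exists_control_period`). No measurable selection is needed: one mean, hence one
control, is chosen on each of the `O(1/ε)` periods, and the errors add up to `O(ε)`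
(`IsOscillatingField.exists_control_approx`). The Lipschitz dependence on the state turns this into
a distance `O(ε)` between the solution for the control so defined and the average trajectory.

For limits of oscillating trajectories, the difference quotient over a short time `h` of a
trajectory of high frequency is an average over many periods, hence close to a mean by convexity. So
are the quotients of the limit, and its derivative is a mean by closedness
(`IsOscillatingField.deriv_mem_periodMeans_of_approx`). Compactness is the Arzelà–Ascoli theorem.

The passage to the manifold uses that the charts of a Riemannian manifold are locally bi-Lipschitz
for its distance (`exists_lipschitzOnWith_extChartAt`, `exists_lipschitzOnWith_extChartAt_symm`), so
that near each point the system is a globally Lipschitz one in `ℝⁿ` (`LocalModel`), and that a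
property of `[0, b]` which propagates across short intervals holds on `[0, T]` (`Icc_induction`):
uniqueness, approximability, the Lipschitz bound and the inclusion of the velocities are all
propagated in this way.
-/

set_option linter.unusedSectionVars false

namespace FastOscillation

/-! ### Bounded closed convex sets in a Hilbert space -/

/-- In a Hilbert space, a decreasing sequence of nonempty closed convex sets that stay in a fixed
ball has a common point: by the parallelogram law the points of minimal norm form a Cauchy
sequence. -/
theorem iInter_nonempty_of_convex_of_bounded {H : Type*} [NormedAddCommGroup H]
    [InnerProductSpace ℝ H] [CompleteSpace H] (C : ℕ → Set H) (hanti : Antitone C)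
    (hne : ∀ j, (C j).Nonempty) (hcl : ∀ j, IsClosed (C j)) (hcv : ∀ j, Convex ℝ (C j))
    (R : ℝ) (hR : ∀ x ∈ C 0, ‖x‖ ≤ R) : (⋂ j, C j).Nonempty := by
  have hmin : ∀ j, ∃ p ∈ C j, ∀ x ∈ C j, ‖p‖ ≤ ‖x‖ := fun j ↦ by
    obtain ⟨p, hp, hpe⟩ :=
      exists_norm_eq_iInf_of_complete_convex (hne j) (hcl j).isComplete (hcv j) 0
    refine ⟨p, hp, fun x hx ↦ ?_⟩
    have h0 : BddBelow (range fun w : C j ↦ ‖(0 : H) - w‖) :=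
      ⟨0, by rintro _ ⟨w, rfl⟩; positivity⟩
    have := ciInf_le h0 ⟨x, hx⟩
    rw [← hpe] at this
    simpa only [zero_sub, norm_neg] using this
  choose p hpC hpmin using hmin
  have hmono : Monotone fun j ↦ ‖p j‖ := fun i j hij ↦ hpmin i _ (hanti hij (hpC j))
  have hkey : ∀ i j, i ≤ j → ‖p i - p j‖ ^ 2 ≤ 2 * ‖p j‖ ^ 2 - 2 * ‖p i‖ ^ 2 := fun i j hij ↦ by
    have hm : (1 / 2 : ℝ) • p i + (1 / 2 : ℝ) • p j ∈ C i :=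
      hcv i (hpC i) (hanti hij (hpC j)) (by norm_num) (by norm_num) (by norm_num)
    have h1 := hpmin i _ hm
    rw [← smul_add, norm_smul] at h1
    have h2 := parallelogram_law_with_norm ℝ (p i) (p j)
    have h3 : 2 * ‖p i‖ ≤ ‖p i + p j‖ := by
      rw [Real.norm_of_nonneg (by norm_num)] at h1; linarith
    nlinarith [norm_nonneg (p i), norm_nonneg (p i + p j)]
  have hbdd : BddAbove (range fun j ↦ ‖p j‖) :=
    ⟨R, by rintro _ ⟨j, rfl⟩; exact hR _ (hanti (Nat.zero_le j) (hpC j))⟩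
  have hlim := (tendsto_atTop_ciSup hmono hbdd).pow 2
  have hcauchy : CauchySeq p := by
    have hc : CauchySeq fun j ↦ ‖p j‖ ^ 2 := hlim.cauchySeq
    rw [Metric.cauchySeq_iff'] at hc ⊢
    intro ε hε
    obtain ⟨N, hN⟩ := hc (ε ^ 2 / 2) (by positivity)
    refine ⟨N, fun j hj ↦ ?_⟩
    have h1 := hkey N j hj
    have h2 := (abs_lt.1 (Real.dist_eq _ _ ▸ hN j hj)).2
    rw [dist_eq_norm, norm_sub_rev]
    exact lt_of_pow_lt_pow_left₀ 2 hε.le (by linarith)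
  obtain ⟨q, hq⟩ := cauchySeq_tendsto_of_complete hcauchy
  refine ⟨q, mem_iInter.2 fun j ↦ (hcl j).mem_of_tendsto hq ?_⟩
  filter_upwards [eventually_ge_atTop j] with i hi using hanti hi (hpC i)

/-! ### Means of an oscillating operator over one period -/

section Means

variable {V W : Type*} [NormedAddCommGroup V] [NormedSpace ℝ V]
  [NormedAddCommGroup W] [InnerProductSpace ℝ W]
  [MeasurableSpace W] [BorelSpace W]

/-- The set of all means `(1/2π) ∫₀^{2π} A(θ) U(θ) dθ` with `U` a measurable map into the unit ball.
The bound `‖U‖ ≤ 1` is imposed at every `θ`, which gives the same set as an essential bound. -/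
def periodMeans (A : ℝ → W →L[ℝ] V) : Set V :=
  {v | ∃ U : ℝ → W, Measurable U ∧ (∀ θ, ‖U θ‖ ≤ 1) ∧
    v = (2 * Real.pi)⁻¹ • ∫ θ in (0 : ℝ)..(2 * Real.pi), A θ (U θ)}

/-- A control in the unit ball of `L^∞` has a measurable representative with values in the unit
ball. -/
theorem exists_measurable_norm_le_one {μ : Measure ℝ} {u : ℝ → W}
    (hu : AEStronglyMeasurable u μ) (hu1 : ∀ᵐ t ∂μ, ‖u t‖ ≤ 1) :
    ∃ u' : ℝ → W, Measurable u' ∧ (∀ t, ‖u' t‖ ≤ 1) ∧ u =ᵐ[μ] u' := by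
  classical
  have hm : Measurable (hu.mk u) := hu.stronglyMeasurable_mk.measurable
  refine ⟨fun t ↦ if ‖hu.mk u t‖ ≤ 1 then hu.mk u t else 0,
    Measurable.ite (measurableSet_le hm.norm measurable_const) hm measurable_const,
    fun t ↦ by dsimp only; split_ifs with h <;> simp [h], ?_⟩
  filter_upwards [hu1, hu.ae_eq_mk] with t h1 h2
  rw [h2] at h1
  simp [h1, h2]

/-- The `2π`-periodic function that agrees with `w` on `[a, a + 2π)`. -/
noncomputable def periodize (a : ℝ) (w : ℝ → W) (θ : ℝ) : W :=
  w (a + 2 * Real.pi * Int.fract ((θ - a) / (2 * Real.pi)))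

theorem periodize_periodic (a : ℝ) (w : ℝ → W) :
    Function.Periodic (periodize a w) (2 * Real.pi) := fun θ ↦ by
  have : (θ + 2 * Real.pi - a) / (2 * Real.pi) = (θ - a) / (2 * Real.pi) + 1 := by
    field_simp; ring
  simp [periodize, this]

theorem periodize_eq {a : ℝ} {w : ℝ → W} {θ : ℝ} (h : θ ∈ Ico a (a + 2 * Real.pi)) :
    periodize a w θ = w θ := by
  have hpi := Real.two_pi_pos
  have : Int.fract ((θ - a) / (2 * Real.pi)) = (θ - a) / (2 * Real.pi) := by
    rw [Int.fract_eq_self]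
    exact ⟨div_nonneg (by linarith [h.1]) hpi.le, by rw [div_lt_one hpi]; linarith [h.2]⟩
  rw [periodize, this]
  congr 1
  field_simp
  ring

theorem measurable_periodize (a : ℝ) {w : ℝ → W} (hw : Measurable w) :
    Measurable (periodize a w) :=
  hw.comp (((measurable_fract.comp
    ((measurable_id.sub_const a).div_const _)).const_mul _).const_add _)

theorem norm_periodize_le (a : ℝ) {w : ℝ → W} (hw : ∀ t, ‖w t‖ ≤ 1) (θ : ℝ) :
    ‖periodize a w θ‖ ≤ 1 := hw _

theorem integral_periodize (a : ℝ) (A : ℝ → W →L[ℝ] V) (hA : Function.Periodic A (2 * Real.pi))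
    (w : ℝ → W) (c : ℝ) :
    ∫ θ in c..(c + 2 * Real.pi), A θ (periodize a w θ) =
      ∫ θ in a..(a + 2 * Real.pi), A θ (w θ) := by
  have hper : Function.Periodic (fun θ ↦ A θ (periodize a w θ)) (2 * Real.pi) := fun θ ↦ by
    simp only [hA θ, periodize_periodic a w θ]
  rw [hper.intervalIntegral_add_eq c a]
  refine intervalIntegral.integral_congr_ae ?_
  have hne : ∀ᵐ θ : ℝ, θ ≠ a + 2 * Real.pi := by simp [ae_iff, measure_singleton]
  filter_upwards [hne] with θ hθ hmem
  rw [uIoc_of_le (by linarith [Real.two_pi_pos])] at hmem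
  rw [periodize_eq ⟨hmem.1.le, lt_of_le_of_ne hmem.2 hθ⟩]

/-- Up to rescaling, every integral of an oscillating operator over one fast period is a mean. -/
theorem exists_integral_period_eq_smul {A : ℝ → W →L[ℝ] V}
    (hA : Function.Periodic A (2 * Real.pi)) {ε : ℝ} (hε : 0 < ε) (c : ℝ) {u : ℝ → W}
    (hu : Measurable u) (hu1 : ∀ t, ‖u t‖ ≤ 1) :
    ∃ v ∈ periodMeans A,
      ∫ s in c..(c + 2 * Real.pi * ε), A (s / ε) (u s) = (2 * Real.pi * ε) • v := by
  let w : ℝ → W := fun θ ↦ u (ε * θ)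
  refine ⟨_, ⟨periodize (c / ε) w, measurable_periodize _ (hu.comp (measurable_id.const_mul ε)),
    norm_periodize_le _ fun t ↦ hu1 _, rfl⟩, ?_⟩
  have h1 := integral_periodize (c / ε) A hA w 0
  have h2 := intervalIntegral.integral_comp_div (a := c) (b := c + 2 * Real.pi * ε)
    (fun θ ↦ A θ (w θ)) hε.ne'
  have h3 : ∀ s, w (s / ε) = u s := fun s ↦ by simp only [w]; congr 1; field_simp
  have h4 : (c + 2 * Real.pi * ε) / ε = c / ε + 2 * Real.pi := by field_simp
  simp only [h3, h4] at h2
  rw [zero_add] at h1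
  rw [h2, h1, smul_smul]
  congr 1
  field_simp [Real.pi_ne_zero]

/-- Every mean is realised over each fast period by a suitable control. -/
theorem exists_control_of_mem_periodMeans {A : ℝ → W →L[ℝ] V}
    (hA : Function.Periodic A (2 * Real.pi)) {ε : ℝ} (hε : 0 < ε) {v : V}
    (hv : v ∈ periodMeans A) :
    ∃ u : ℝ → W, Measurable u ∧ (∀ t, ‖u t‖ ≤ 1) ∧
      ∀ c, ∫ s in c..(c + 2 * Real.pi * ε), A (s / ε) (u s) = (2 * Real.pi * ε) • v := by
  obtain ⟨U, hU, hU1, rfl⟩ := hv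
  refine ⟨fun s ↦ periodize 0 U (s / ε), (measurable_periodize 0 hU).comp
    (measurable_id.div_const ε), fun t ↦ norm_periodize_le 0 hU1 _, fun c ↦ ?_⟩
  have h1 := integral_periodize 0 A hA U (c / ε)
  have h2 := intervalIntegral.integral_comp_div (a := c) (b := c + 2 * Real.pi * ε)
    (fun θ ↦ A θ (periodize 0 U θ)) hε.ne'
  have h4 : (c + 2 * Real.pi * ε) / ε = c / ε + 2 * Real.pi := by field_simp
  rw [zero_add] at h1
  rw [h2, h4, h1, smul_smul]
  congr 1
  field_simp [Real.pi_ne_zero]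

variable [FiniteDimensional ℝ W]

theorem stronglyMeasurable_apply {A : ℝ → W →L[ℝ] V} (hA : Continuous A) {u : ℝ → W}
    (hu : Measurable u) : StronglyMeasurable fun θ ↦ A θ (u θ) := by
  have h : Continuous fun p : (W →L[ℝ] V) × W ↦ p.1 p.2 := by fun_prop
  exact h.comp_stronglyMeasurable (hA.stronglyMeasurable.prodMk hu.stronglyMeasurable)

theorem norm_apply_le_of_le {f : W →L[ℝ] V} {B : ℝ} (hf : ‖f‖ ≤ B) {w : W} (hw : ‖w‖ ≤ 1) :
    ‖f w‖ ≤ B :=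
  (f.le_opNorm w).trans <| by nlinarith [norm_nonneg f, norm_nonneg w]

theorem intervalIntegrable_apply {A : ℝ → W →L[ℝ] V} (hA : Continuous A) {u : ℝ → W}
    (hu : Measurable u) (hu1 : ∀ t, ‖u t‖ ≤ 1) (a b : ℝ) :
    IntervalIntegrable (fun θ ↦ A θ (u θ)) volume a b := by
  refine (hA.norm.intervalIntegrable a b).mono_fun
    (stronglyMeasurable_apply hA hu).aestronglyMeasurable (Eventually.of_forall fun θ ↦ ?_)
  simpa using norm_apply_le_of_le le_rfl (hu1 θ)

theorem convex_periodMeans {A : ℝ → W →L[ℝ] V} (hA : Continuous A) :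
    Convex ℝ (periodMeans A) := by
  rintro _ ⟨U, hU, hU1, rfl⟩ _ ⟨U', hU', hU1', rfl⟩ a b ha hb hab
  refine ⟨fun θ ↦ a • U θ + b • U' θ, (hU.const_smul a).add (hU'.const_smul b), fun θ ↦ ?_, ?_⟩
  · refine (norm_add_le _ _).trans ?_
    rw [norm_smul, norm_smul, Real.norm_of_nonneg ha, Real.norm_of_nonneg hb]
    nlinarith [hU1 θ, hU1' θ]
  · have hi := intervalIntegrable_apply hA hU hU1 0 (2 * Real.pi)
    have hi' := intervalIntegrable_apply hA hU' hU1' 0 (2 * Real.pi)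
    simp only [map_add, map_smul]
    rw [intervalIntegral.integral_add (f := fun θ ↦ a • A θ (U θ)) (g := fun θ ↦ b • A θ (U' θ))
      (hi.smul a) (hi'.smul b), intervalIntegral.integral_smul,
      intervalIntegral.integral_smul, smul_add, smul_comm a, smul_comm b]

theorem norm_le_of_mem_periodMeans {A : ℝ → W →L[ℝ] V} {B : ℝ} (hB : ∀ θ, ‖A θ‖ ≤ B) {v : V}
    (hv : v ∈ periodMeans A) : ‖v‖ ≤ B := by
  obtain ⟨U, -, hU1, rfl⟩ := hv
  have hpi := Real.two_pi_pos
  have := intervalIntegral.norm_integral_le_of_norm_le_const (a := 0) (b := 2 * Real.pi)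
    (f := fun θ ↦ A θ (U θ)) (C := B) fun θ _ ↦ norm_apply_le_of_le (hB θ) (hU1 θ)
  rw [sub_zero, abs_of_pos hpi] at this
  rw [norm_smul, norm_inv, Real.norm_of_nonneg hpi.le, inv_mul_le_iff₀ hpi,
    mul_comm (2 * Real.pi) B]
  exact this

/-- Nearby operators have nearby means. -/
theorem exists_mem_periodMeans_dist_le {A A' : ℝ → W →L[ℝ] V} (hA : Continuous A)
    (hA' : Continuous A') {δ : ℝ} (hδ : ∀ θ, ‖A θ - A' θ‖ ≤ δ) {v : V} (hv : v ∈ periodMeans A) :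
    ∃ v' ∈ periodMeans A', ‖v - v'‖ ≤ δ := by
  obtain ⟨U, hU, hU1, rfl⟩ := hv
  refine ⟨_, ⟨U, hU, hU1, rfl⟩, ?_⟩
  rw [← smul_sub, ← intervalIntegral.integral_sub (intervalIntegrable_apply hA hU hU1 _ _)
    (intervalIntegrable_apply hA' hU hU1 _ _)]
  exact norm_le_of_mem_periodMeans (A := fun θ ↦ A θ - A' θ) hδ ⟨U, hU, hU1, by simp⟩

/-- The set of means is closed: it is the image of the unit ball of `L^∞`, a closed convex bounded
subset of the Hilbert space `L²`, under a map that is continuous along `L²`-convergent sequences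
of this ball. -/
theorem isClosed_periodMeans {A : ℝ → W →L[ℝ] V} (hA : Continuous A) {B : ℝ}
    (hB : ∀ θ, ‖A θ‖ ≤ B) : IsClosed (periodMeans A) := by
  have hpi := Real.two_pi_pos
  let μ : Measure ℝ := volume.restrict (Ioc 0 (2 * Real.pi))
  let S : (ℝ → W) → V := fun U ↦ (2 * Real.pi)⁻¹ • ∫ θ, A θ (U θ) ∂μ
  have hS : ∀ U, (2 * Real.pi)⁻¹ • ∫ θ in (0 : ℝ)..(2 * Real.pi), A θ (U θ) = S U := fun U ↦ by
    simp only [S, μ, intervalIntegral.integral_of_le hpi.le]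
  have hmeas : ∀ U : Lp W 2 μ, AEStronglyMeasurable (fun θ ↦ A θ (U θ)) μ := fun U ↦ by
    have : Continuous fun p : (W →L[ℝ] V) × W ↦ p.1 p.2 := by fun_prop
    exact this.comp_aestronglyMeasurable
      (hA.aestronglyMeasurable.prodMk (Lp.aestronglyMeasurable U))
  have hint : ∀ U : Lp W 2 μ, (∀ᵐ θ ∂μ, ‖U θ‖ ≤ 1) → Integrable (fun θ ↦ A θ (U θ)) μ :=
    fun U hU ↦ Integrable.of_bound (hmeas U) B
      (hU.mono fun θ hθ ↦ norm_apply_le_of_le (hB θ) hθ)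
  refine isClosed_of_closure_subset fun y hy ↦ ?_
  let C : ℕ → Set (Lp W 2 μ) := fun j ↦
    {U | (∀ᵐ θ ∂μ, ‖U θ‖ ≤ 1) ∧ ‖S U - y‖ ≤ 1 / ((j : ℝ) + 1)}
  have hanti : Antitone C := fun i j hij U hU ↦
    ⟨hU.1, hU.2.trans (one_div_le_one_div_of_le (by positivity) (by gcongr))⟩
  have hne : ∀ j, (C j).Nonempty := fun j ↦ by
    obtain ⟨v, ⟨U, hU, hU1, rfl⟩, hv⟩ := Metric.mem_closure_iff.1 hy (1 / ((j : ℝ) + 1))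
      (by positivity)
    have hmem : MemLp U 2 μ := MemLp.of_bound hU.aestronglyMeasurable 1 (Eventually.of_forall hU1)
    have hae := hmem.coeFn_toLp
    refine ⟨hmem.toLp U, ?_, ?_⟩
    · filter_upwards [hae] with θ hθ using hθ ▸ hU1 θ
    · have : S (hmem.toLp U) = S U := by
        simp only [S]
        congr 1
        exact integral_congr_ae (hae.mono fun θ hθ ↦ by simp only [hθ])
      rw [this, ← hS, ← dist_eq_norm, dist_comm]
      exact hv.le
  have hcv : ∀ j, Convex ℝ (C j) := by
    rintro j U ⟨hU, hUy⟩ U' ⟨hU', hUy'⟩ a b ha hb hab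
    have hae : ∀ᵐ θ ∂μ, (a • U + b • U' : Lp W 2 μ) θ = a • U θ + b • U' θ := by
      filter_upwards [Lp.coeFn_add (a • U) (b • U'), Lp.coeFn_smul a U, Lp.coeFn_smul b U']
        with θ h1 h2 h3
      rw [h1, Pi.add_apply, h2, h3, Pi.smul_apply, Pi.smul_apply]
    refine ⟨?_, ?_⟩
    · filter_upwards [hU, hU', hae] with θ h h' h1
      rw [h1]
      refine (norm_add_le _ _).trans ?_
      rw [norm_smul, norm_smul, Real.norm_of_nonneg ha, Real.norm_of_nonneg hb]
      nlinarith
    · have h1 : S (a • U + b • U' : Lp W 2 μ) = a • S U + b • S U' := by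
        simp only [S]
        rw [integral_congr_ae (hae.mono fun θ hθ ↦ by
          show A θ _ = a • A θ (U θ) + b • A θ (U' θ)
          rw [hθ, map_add, map_smul, map_smul]),
          integral_add (f := fun θ ↦ a • A θ (U θ)) (g := fun θ ↦ b • A θ (U' θ))
            ((hint U hU).smul a) ((hint U' hU').smul b), integral_smul, integral_smul,
          smul_add, smul_comm a, smul_comm b]
      have h2 : S (a • U + b • U' : Lp W 2 μ) - y = a • (S U - y) + b • (S U' - y) := by
        rw [h1, smul_sub, smul_sub]
        nth_rewrite 1 [← one_smul ℝ y]
        rw [← hab, add_smul]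
        abel
      rw [h2]
      refine (norm_add_le _ _).trans ?_
      rw [norm_smul, norm_smul, Real.norm_of_nonneg ha, Real.norm_of_nonneg hb]
      calc _ ≤ a * (1 / ((j : ℝ) + 1)) + b * (1 / ((j : ℝ) + 1)) := by gcongr
        _ = _ := by rw [← add_mul, hab, one_mul]
  have hcl : ∀ j, IsClosed (C j) := fun j ↦ by
    refine IsSeqClosed.isClosed fun f U hf hU ↦ ?_
    obtain ⟨ns, -, hns⟩ := (tendstoInMeasure_of_tendsto_Lp hU).exists_seq_tendsto_ae
    have hf1 : ∀ᵐ θ ∂μ, ∀ k, ‖f (ns k) θ‖ ≤ 1 := ae_all_iff.2 fun k ↦ (hf (ns k)).1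
    refine ⟨?_, ?_⟩
    · filter_upwards [hns, hf1] with θ h h1
      exact le_of_tendsto h.norm (Eventually.of_forall h1)
    · have hlim : Tendsto (fun k ↦ S (f (ns k))) atTop (𝓝 (S U)) := by
        refine Tendsto.const_smul ?_ _
        refine tendsto_integral_of_dominated_convergence (fun _ ↦ B) (fun k ↦ hmeas _)
          (integrable_const B) (fun k ↦ ?_) ?_
        · filter_upwards [hf1] with θ h1 using norm_apply_le_of_le (hB θ) (h1 k)
        · filter_upwards [hns] with θ h using ((A θ).continuous.tendsto _).comp h
      exact le_of_tendsto (hlim.sub_const y).norm (Eventually.of_forall fun k ↦ (hf (ns k)).2)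
  obtain ⟨R, hR⟩ : ∃ R : ℝ, ∀ U ∈ C 0, ‖U‖ ≤ R :=
    ⟨_, fun U hU ↦ Lp.norm_le_of_ae_bound zero_le_one hU.1⟩
  obtain ⟨U, hU⟩ := iInter_nonempty_of_convex_of_bounded C hanti hne hcl hcv R hR
  rw [mem_iInter] at hU
  obtain ⟨U', hU', hU1', hae⟩ :=
    exists_measurable_norm_le_one (Lp.aestronglyMeasurable U) (hU 0).1
  refine ⟨U', hU', hU1', ?_⟩
  have hSU : S U = S U' := by
    simp only [S]
    congr 1
    exact integral_congr_ae (hae.mono fun θ hθ ↦ by simp only [hθ])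
  rw [hS, ← hSU, eq_comm, ← sub_eq_zero, ← norm_le_zero_iff]
  exact ge_of_tendsto' tendsto_one_div_add_atTop_nhds_zero_nat fun j ↦ (hU j).2

end Means

/-! ### Oscillating systems in a vector space -/

section VectorSpace

variable {V W : Type*} [NormedAddCommGroup V] [NormedSpace ℝ V] [CompleteSpace V]
  [NormedAddCommGroup W] [InnerProductSpace ℝ W] [FiniteDimensional ℝ W]
  [MeasurableSpace W] [BorelSpace W]

/-- The system `ξ' = F(t/ε, ξ) u` on a normed space `V`, linear in the control `u ∈ W`: `F` is
jointly continuous, `2π`-periodic in the angle, bounded by `B`, and `L`-Lipschitz in the state. -/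
structure IsOscillatingField (F : ℝ → V → W →L[ℝ] V) (B L : ℝ) : Prop where
  continuous : Continuous fun p : ℝ × V ↦ F p.1 p.2
  periodic : ∀ ξ, Function.Periodic (fun θ ↦ F θ ξ) (2 * Real.pi)
  bound : ∀ θ ξ, ‖F θ ξ‖ ≤ B
  lipschitz : ∀ θ ξ η, ‖F θ ξ - F θ η‖ ≤ L * ‖ξ - η‖

namespace IsOscillatingField

variable {F : ℝ → V → W →L[ℝ] V} {B L : ℝ}

theorem bound_nonneg (hF : IsOscillatingField F B L) : 0 ≤ B :=
  (norm_nonneg _).trans (hF.bound 0 0)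

theorem continuous_angle (hF : IsOscillatingField F B L) (ξ : V) : Continuous fun θ ↦ F θ ξ :=
  hF.continuous.comp (Continuous.prodMk_left ξ)

theorem continuous_along (hF : IsOscillatingField F B L) (ε : ℝ) {ξ : ℝ → V}
    (hξ : Continuous ξ) : Continuous fun s ↦ F (s / ε) (ξ s) :=
  hF.continuous.comp ((continuous_id.div_const ε).prodMk hξ)

theorem intervalIntegrable (hF : IsOscillatingField F B L) (ε : ℝ) {ξ : ℝ → V}
    (hξ : Continuous ξ) {u : ℝ → W} (hu : Measurable u) (hu1 : ∀ t, ‖u t‖ ≤ 1) (a b : ℝ) :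
    IntervalIntegrable (fun s ↦ F (s / ε) (ξ s) (u s)) volume a b :=
  intervalIntegrable_apply (hF.continuous_along ε hξ) hu hu1 a b

theorem norm_sub_apply_le (hF : IsOscillatingField F B L) (θ : ℝ) (ξ η : V) {w : W}
    (hw : ‖w‖ ≤ 1) : ‖F θ ξ w - F θ η w‖ ≤ L * ‖ξ - η‖ := by
  rw [← sub_apply]
  exact norm_apply_le_of_le (hF.lipschitz θ ξ η) hw

/-- Replacing the state along a control changes the integral by at most the Lipschitz estimate. -/
theorem norm_integral_sub_le (hF : IsOscillatingField F B L) (hL0 : 0 ≤ L) (ε : ℝ) {ξ η : ℝ → V}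
    (hξ : Continuous ξ) (hη : Continuous η) {u : ℝ → W} (hu : Measurable u)
    (hu1 : ∀ t, ‖u t‖ ≤ 1) {a b ρ : ℝ} (hab : a ≤ b)
    (hρ : ∀ s ∈ Icc a b, ‖ξ s - η s‖ ≤ ρ) :
    ‖(∫ s in a..b, F (s / ε) (ξ s) (u s)) - ∫ s in a..b, F (s / ε) (η s) (u s)‖ ≤
      L * ρ * (b - a) := by
  rw [← intervalIntegral.integral_sub (hF.intervalIntegrable ε hξ hu hu1 a b)
    (hF.intervalIntegrable ε hη hu hu1 a b)]
  refine (intervalIntegral.norm_integral_le_of_norm_le_const (C := L * ρ) fun s hs ↦ ?_).trans_eq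
    (by rw [abs_of_nonneg (sub_nonneg.2 hab)])
  rw [uIoc_of_le hab] at hs
  exact (hF.norm_sub_apply_le _ _ _ (hu1 s)).trans
    (mul_le_mul_of_nonneg_left (hρ s ⟨hs.1.le, hs.2⟩) hL0)

/-- Existence of Carathéodory solutions on a short interval, by contraction. -/
theorem exists_solution (hF : IsOscillatingField F B L) (hL0 : 0 ≤ L) (ε : ℝ) {a b : ℝ}
    (hab : a ≤ b) (hL : L * (b - a) ≤ 1 / 2) {u : ℝ → W} (hu : Measurable u)
    (hu1 : ∀ t, ‖u t‖ ≤ 1) (ξa : V) :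
    ∃ ξ : ℝ → V, Continuous ξ ∧
      ∀ t ∈ Icc a b, ξ t = ξa + ∫ s in a..t, F (s / ε) (ξ s) (u s) := by
  have hcont : ∀ x : C(Icc a b, V), Continuous (IccExtend hab x) := fun x ↦
    x.continuous.Icc_extend'
  let Φ : C(Icc a b, V) → C(Icc a b, V) := fun x ↦
    ⟨fun t ↦ ξa + ∫ s in a..t, F (s / ε) (IccExtend hab x s) (u s),
      continuous_const.add ((intervalIntegral.continuous_primitive
        (fun a b ↦ hF.intervalIntegrable ε (hcont x) hu hu1 a b) a).comp continuous_subtype_val)⟩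
  have hΦ : ContractingWith (1 / 2) Φ := by
    refine ⟨by norm_num, LipschitzWith.of_dist_le_mul fun x y ↦ ?_⟩
    rw [ContinuousMap.dist_le (by positivity)]
    intro t
    rw [dist_eq_norm]
    simp only [Φ, ContinuousMap.coe_mk, add_sub_add_left_eq_sub]
    refine (hF.norm_integral_sub_le hL0 ε (hcont x) (hcont y) hu hu1 t.2.1
      (ρ := dist x y) fun s _ ↦ ?_).trans ?_
    · rw [← dist_eq_norm]
      exact ContinuousMap.dist_apply_le_dist _
    · have h1 : L * (t - a) ≤ 1 / 2 := le_trans (by gcongr; exact t.2.2) hL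
      have h2 : (0 : ℝ) ≤ dist x y := dist_nonneg
      push_cast
      nlinarith
  have : Nonempty C(Icc a b, V) := ⟨ContinuousMap.const _ 0⟩
  let x := ContractingWith.fixedPoint Φ hΦ
  have hx : Φ x = x := hΦ.fixedPoint_isFixedPt
  refine ⟨IccExtend hab x, hcont x, fun t ht ↦ ?_⟩
  rw [IccExtend_of_mem hab _ ht]
  conv_lhs => rw [← hx]
  rfl

/-- On a short interval, a curve that solves the integral equation up to an error `δ` stays close to
the exact solution. -/
theorem norm_solution_sub_le (hF : IsOscillatingField F B L) (hL0 : 0 ≤ L) (ε : ℝ) {a b : ℝ}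
    (hL : L * (b - a) ≤ 1 / 2) {u : ℝ → W} (hu : Measurable u)
    (hu1 : ∀ t, ‖u t‖ ≤ 1) {ξ η : ℝ → V} (hξ : Continuous ξ) (hη : Continuous η) {δ : ℝ}
    (hξe : ∀ t ∈ Icc a b, ξ t = ξ a + ∫ s in a..t, F (s / ε) (ξ s) (u s))
    (hηe : ∀ t ∈ Icc a b, ‖η t - η a - ∫ s in a..t, F (s / ε) (η s) (u s)‖ ≤ δ) :
    ∀ t ∈ Icc a b, ‖ξ t - η t‖ ≤ 2 * (‖ξ a - η a‖ + δ) := by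
  intro t₀ ht₀
  obtain ⟨t, ht, hmax⟩ := isCompact_Icc.exists_isMaxOn ⟨t₀, ht₀⟩
    ((hξ.sub hη).norm.continuousOn (s := Icc a b))
  refine (hmax ht₀).trans ?_
  have h1 : ‖(∫ s in a..t, F (s / ε) (ξ s) (u s)) - ∫ s in a..t, F (s / ε) (η s) (u s)‖ ≤
      L * ‖ξ t - η t‖ * (t - a) :=
    hF.norm_integral_sub_le hL0 ε hξ hη hu hu1 ht.1
      fun s hs ↦ hmax ⟨hs.1, hs.2.trans ht.2⟩
  have h2 : ξ t - η t = (ξ a - η a) - (η t - η a - ∫ s in a..t, F (s / ε) (η s) (u s)) +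
      ((∫ s in a..t, F (s / ε) (ξ s) (u s)) - ∫ s in a..t, F (s / ε) (η s) (u s)) := by
    rw [hξe t ht]; abel
  have h3 : ‖ξ t - η t‖ ≤ ‖ξ a - η a‖ + δ + L * ‖ξ t - η t‖ * (t - a) := by
    conv_lhs => rw [h2]
    exact (norm_add_le _ _).trans (add_le_add ((norm_sub_le _ _).trans
      (add_le_add le_rfl (hηe t ht))) h1)
  have h4 : L * (t - a) ≤ 1 / 2 := le_trans (by gcongr; exact ht.2) hL
  show ‖ξ t - η t‖ ≤ _
  nlinarith [norm_nonneg (ξ t - η t)]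

/-! ### Approximation of averaged trajectories -/

/-- The increment over one fast period of a curve with velocities in the sets of means is produced,
up to an error of second order, by a control over this period. The velocities are close to the
convex set of means at the initial point of the period, hence so is their average: no measurable
selection of controls is needed. -/
theorem exists_control_period (hF : IsOscillatingField F B L) (hL0 : 0 ≤ L) {ε : ℝ} (hε : 0 < ε)
    {c : ℝ} {η g : ℝ → V} {K : NNReal} (hη : LipschitzWith K η)
    (hg : IntervalIntegrable g volume c (c + 2 * Real.pi * ε))
    (hηg : η (c + 2 * Real.pi * ε) - η c = ∫ s in c..(c + 2 * Real.pi * ε), g s)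
    (hmem : ∀ᵐ s, s ∈ Ioo c (c + 2 * Real.pi * ε) → g s ∈ periodMeans fun θ ↦ F θ (η s)) :
    ∃ u : ℝ → W, Measurable u ∧ (∀ t, ‖u t‖ ≤ 1) ∧
      ‖η (c + 2 * Real.pi * ε) - η c -
        ∫ s in c..(c + 2 * Real.pi * ε), F (s / ε) (η s) (u s)‖ ≤
        (2 * L * K + 1) * (2 * Real.pi * ε) ^ 2 := by
  set τ := 2 * Real.pi * ε with hτ
  have hτ0 : 0 < τ := by positivity
  let S := periodMeans fun θ ↦ F θ (η c)
  have hclose : ∀ s ∈ Icc c (c + τ), ‖η s - η c‖ ≤ K * τ := fun s hs ↦ by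
    rw [← dist_eq_norm]
    refine (hη.dist_le_mul s c).trans ?_
    gcongr
    rw [Real.dist_eq, abs_of_nonneg (by linarith [hs.1])]
    linarith [hs.2]
  have hav : (⨍ s in Ioc c (c + τ), g s) ∈ Metric.cthickening (L * (K * τ)) S := by
    refine ((convex_periodMeans (hF.continuous_angle _)).cthickening _).set_average_mem
      Metric.isClosed_cthickening (by simp [hτ0]) (by simp) ?_
      ((intervalIntegrable_iff_integrableOn_Ioc_of_le (by linarith)).1 hg)
    rw [← Measure.restrict_congr_set Ioo_ae_eq_Ioc, ae_restrict_iff' measurableSet_Ioo]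
    filter_upwards [hmem] with s hs hsI
    obtain ⟨v, hv, hgv⟩ := exists_mem_periodMeans_dist_le (hF.continuous_angle _)
      (hF.continuous_angle (η c)) (fun θ ↦ hF.lipschitz θ (η s) (η c)) (hs hsI)
    refine Metric.mem_cthickening_of_dist_le _ v _ _ hv ?_
    rw [dist_eq_norm]
    exact hgv.trans (mul_le_mul_of_nonneg_left (hclose s ⟨hsI.1.le, hsI.2.le⟩) hL0)
  have hav' : τ • (⨍ s in Ioc c (c + τ), g s) = η (c + τ) - η c := by
    rw [hηg, intervalIntegral.integral_of_le (by linarith), setAverage_eq, smul_smul]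
    simp [Measure.real, hτ0.le, hτ0.ne']
  obtain ⟨v, hv, hdist⟩ := Metric.mem_thickening_iff.1
    (Metric.cthickening_subset_thickening' (δ₂ := L * (K * τ) + τ) (by positivity)
      (by linarith) S hav)
  obtain ⟨u, hu, hu1, hint⟩ := exists_control_of_mem_periodMeans (hF.periodic (η c)) hε hv
  refine ⟨u, hu, hu1, ?_⟩
  have h1 : ‖(∫ s in c..(c + τ), F (s / ε) (η s) (u s)) -
      ∫ s in c..(c + τ), F (s / ε) (η c) (u s)‖ ≤ L * (K * τ) * (c + τ - c) :=
    hF.norm_integral_sub_le hL0 ε hη.continuous continuous_const hu hu1 (by linarith) hclose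
  rw [hint c, ← hτ] at h1
  have h2 : ‖η (c + τ) - η c - τ • v‖ ≤ τ * (L * (K * τ) + τ) := by
    rw [← hav', ← smul_sub, norm_smul, Real.norm_of_nonneg hτ0.le, ← dist_eq_norm]
    gcongr
  have h3 : η (c + τ) - η c - ∫ s in c..(c + τ), F (s / ε) (η s) (u s) =
      (η (c + τ) - η c - τ • v) - ((∫ s in c..(c + τ), F (s / ε) (η s) (u s)) - τ • v) := by abel
  rw [h3]
  refine (norm_sub_le _ _).trans ((add_le_add h2 h1).trans_eq ?_)
  ring

/-- A curve whose velocities lie in the sets of means solves the oscillating integral equation up to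
an error of order `ε`, for a suitable control. -/
theorem exists_control_approx (hF : IsOscillatingField F B L) (hL0 : 0 ≤ L) {a b : ℝ}
    (hab : a ≤ b) {η g : ℝ → V} {K : NNReal} (hη : LipschitzWith K η)
    (hg : IntervalIntegrable g volume a b)
    (hηg : ∀ s ∈ Icc a b, ∀ t ∈ Icc a b, η t - η s = ∫ r in s..t, g r)
    (hmem : ∀ᵐ s, s ∈ Ioo a b → g s ∈ periodMeans fun θ ↦ F θ (η s)) :
    ∃ C : ℝ, 0 ≤ C ∧ ∀ ε, 0 < ε → ∃ u : ℝ → W, Measurable u ∧ (∀ t, ‖u t‖ ≤ 1) ∧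
      ∀ t ∈ Icc a b, ‖η t - η a - ∫ s in a..t, F (s / ε) (η s) (u s)‖ ≤ C * ε := by
  classical
  have hB0 := hF.bound_nonneg
  have hba : 0 ≤ b - a := sub_nonneg.2 hab
  set C₁ : ℝ := 2 * L * K + 1 with hC₁
  have hC₁0 : 0 ≤ C₁ := by positivity
  refine ⟨2 * Real.pi * (C₁ * (b - a) + K + B), by positivity, fun ε hε ↦ ?_⟩
  set τ := 2 * Real.pi * ε with hτ
  have hτ0 : 0 < τ := by positivity
  -- the control on the `k`-th period, provided that this period lies in `[a, b]`
  have hper : ∀ k : ℕ, ∃ u : ℝ → W, Measurable u ∧ (∀ t, ‖u t‖ ≤ 1) ∧ (a + k * τ + τ ≤ b →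
      ‖η (a + k * τ + τ) - η (a + k * τ) -
        ∫ s in (a + k * τ)..(a + k * τ + τ), F (s / ε) (η s) (u s)‖ ≤ C₁ * τ ^ 2) := fun k ↦ by
    by_cases hk : a + k * τ + τ ≤ b
    · have hkτ : 0 ≤ k * τ := by positivity
      have hsub : Icc (a + k * τ) (a + k * τ + τ) ⊆ Icc a b := Icc_subset_Icc (by linarith) hk
      have hle : a + k * τ ≤ a + k * τ + τ := by linarith
      obtain ⟨u, hu, hu1, h⟩ := hF.exists_control_period hL0 hε hη
        (c := a + k * τ) (g := g)
        (hg.mono_set (by rwa [uIcc_of_le hle, uIcc_of_le hab]))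
        (hηg _ (hsub ⟨le_rfl, hle⟩) _ (hsub ⟨hle, le_rfl⟩))
        (hmem.mono fun s hs hsI ↦ hs ⟨by linarith [hsI.1], lt_of_lt_of_le hsI.2 hk⟩)
      exact ⟨u, hu, hu1, fun _ ↦ h⟩
    · exact ⟨fun _ ↦ 0, measurable_const, by simp, fun h ↦ (hk h).elim⟩
  choose v hv hv1 hvint using hper
  let u : ℝ → W := fun t ↦ v ⌊(t - a) / τ⌋₊ t
  have hu : Measurable u := by
    have h : Measurable fun p : ℕ × ℝ ↦ v p.1 p.2 := measurable_from_prod_countable_right hv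
    exact h.comp ((Nat.measurable_floor.comp
      ((measurable_id.sub_const a).div_const τ)).prodMk measurable_id)
  have hu1 : ∀ t, ‖u t‖ ≤ 1 := fun t ↦ hv1 _ t
  have hui : ∀ s t, IntervalIntegrable (fun s ↦ F (s / ε) (η s) (u s)) volume s t :=
    hF.intervalIntegrable ε hη.continuous hu hu1
  let D : ℝ → V := fun t ↦ η t - η a - ∫ s in a..t, F (s / ε) (η s) (u s)
  have hD : ∀ s t, D t - D s = η t - η s - ∫ r in s..t, F (r / ε) (η r) (u r) := fun s t ↦ by
    simp only [D]
    rw [← intervalIntegral.integral_add_adjacent_intervals (hui a s) (hui s t)]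
    abel
  have hk : ∀ k : ℕ, a + k * τ ≤ b → ‖D (a + k * τ)‖ ≤ k * (C₁ * τ ^ 2) := by
    intro k
    induction k with
    | zero => intro _; simp [D]
    | succ k ih =>
      intro hkb
      have he : a + ((k + 1 : ℕ) : ℝ) * τ = a + k * τ + τ := by push_cast; ring
      rw [he] at hkb ⊢
      have h1 := ih (by linarith)
      have h2 : ‖D (a + k * τ + τ) - D (a + k * τ)‖ ≤ C₁ * τ ^ 2 := by
        rw [hD]
        refine le_of_eq_of_le ?_ (hvint k hkb)
        congr 2
        refine intervalIntegral.integral_congr_ae ?_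
        have hne : ∀ᵐ s : ℝ, s ≠ a + k * τ + τ := by simp [ae_iff, measure_singleton]
        filter_upwards [hne] with s hs hsI
        rw [uIoc_of_le (by linarith)] at hsI
        have hfl : ⌊(s - a) / τ⌋₊ = k := by
          have hlt : s < a + k * τ + τ := lt_of_le_of_ne hsI.2 hs
          rw [Nat.floor_eq_iff (div_nonneg (by nlinarith [hsI.1, Nat.cast_nonneg (α := ℝ) k])
            hτ0.le), le_div_iff₀ hτ0, div_lt_iff₀ hτ0]
          exact ⟨by linarith [hsI.1], by linarith⟩
        simp only [u, hfl]
      have h3 := norm_add_le (D (a + k * τ + τ) - D (a + k * τ)) (D (a + k * τ))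
      rw [sub_add_cancel] at h3
      push_cast
      linarith
  refine ⟨u, hu, hu1, fun t ht ↦ ?_⟩
  set k := ⌊(t - a) / τ⌋₊ with hkdef
  have hk1 : a + k * τ ≤ t := by
    have := Nat.floor_le (div_nonneg (sub_nonneg.2 ht.1) hτ0.le)
    rw [← hkdef, le_div_iff₀ hτ0] at this
    linarith
  have hk2 : t < a + k * τ + τ := by
    have := Nat.lt_floor_add_one ((t - a) / τ)
    rw [← hkdef, div_lt_iff₀ hτ0] at this
    linarith
  have h1 := hk k (hk1.trans ht.2)
  have h2 : ‖D t - D (a + k * τ)‖ ≤ (K + B) * τ := by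
    rw [hD]
    refine (norm_sub_le _ _).trans ?_
    have h3 : ‖η t - η (a + k * τ)‖ ≤ K * τ := by
      rw [← dist_eq_norm]
      refine (hη.dist_le_mul _ _).trans ?_
      gcongr
      rw [Real.dist_eq, abs_of_nonneg (by linarith)]
      linarith
    have h4 : ‖∫ r in (a + k * τ)..t, F (r / ε) (η r) (u r)‖ ≤ B * τ := by
      refine (intervalIntegral.norm_integral_le_of_norm_le_const
        fun s _ ↦ norm_apply_le_of_le (hF.bound _ _) (hu1 s)).trans ?_
      gcongr
      rw [abs_of_nonneg (by linarith)]
      linarith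
    linarith
  have h3 := norm_add_le (D t - D (a + k * τ)) (D (a + k * τ))
  rw [sub_add_cancel] at h3
  have h5 : k * τ ≤ b - a := by linarith [ht.2]
  have h6 : k * (C₁ * τ ^ 2) ≤ C₁ * (b - a) * τ := by
    have := mul_le_mul_of_nonneg_left h5 (mul_nonneg hC₁0 hτ0.le)
    nlinarith
  show ‖D t‖ ≤ _
  have h7 : 2 * Real.pi * (C₁ * (b - a) + K + B) * ε =
      C₁ * (b - a) * τ + (K + B) * τ := by rw [hτ]; ring
  rw [h7]
  linarith

/-! ### Velocities of limits of oscillating trajectories -/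

/-- The integral of an oscillating operator against a control over an interval of length `h` is `h`
times a mean, up to the contribution of one fast period. -/
theorem exists_mem_periodMeans_norm_integral_sub_le {A : ℝ → W →L[ℝ] V} (hA : Continuous A)
    (hper : Function.Periodic A (2 * Real.pi)) (hB : ∀ θ, ‖A θ‖ ≤ B) {ε h : ℝ} (hε : 0 < ε)
    (hh : 0 < h) (t : ℝ) {u : ℝ → W} (hu : Measurable u) (hu1 : ∀ t, ‖u t‖ ≤ 1) :
    ∃ e ∈ periodMeans A,
      ‖(∫ s in t..(t + h), A (s / ε) (u s)) - h • e‖ ≤ 2 * Real.pi * ε * B := by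
  classical
  set τ := 2 * Real.pi * ε with hτ
  have hτ0 : 0 < τ := by positivity
  -- extend the control by zero up to a whole number `N` of periods
  set N := ⌈h / τ⌉₊ with hN
  have hN0 : 0 < N := Nat.ceil_pos.2 (by positivity)
  have hN0' : (0 : ℝ) < N := by exact_mod_cast hN0
  have hN1 : h ≤ N * τ := by
    have := Nat.le_ceil (h / τ)
    rwa [← hN, div_le_iff₀ hτ0] at this
  have hN2 : N * τ < h + τ := by
    have := Nat.ceil_lt_add_one (div_nonneg hh.le hτ0.le)
    rw [← hN, ← sub_lt_iff_lt_add, lt_div_iff₀ hτ0] at this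
    linarith
  let w : ℝ → W := fun s ↦ if s ≤ t + h then u s else 0
  have hw : Measurable w := Measurable.ite measurableSet_Iic hu measurable_const
  have hw1 : ∀ s, ‖w s‖ ≤ 1 := fun s ↦ by
    simp only [w]; split_ifs with hs
    exacts [hu1 s, by simp]
  have hAε : Continuous fun s ↦ A (s / ε) := hA.comp (continuous_id.div_const ε)
  have hwi : ∀ x y, IntervalIntegrable (fun s ↦ A (s / ε) (w s)) volume x y :=
    intervalIntegrable_apply hAε hw hw1
  have hsplit : ∫ s in t..(t + N * τ), A (s / ε) (w s) = ∫ s in t..(t + h), A (s / ε) (u s) := by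
    rw [← intervalIntegral.integral_add_adjacent_intervals (hwi t (t + h)) (hwi (t + h) _)]
    have h1 : ∫ s in (t + h)..(t + N * τ), A (s / ε) (w s) = 0 := by
      refine intervalIntegral.integral_zero_ae (Eventually.of_forall fun s hs ↦ ?_)
      rw [uIoc_of_le (by linarith)] at hs
      simp [w, not_le.2 hs.1]
    rw [h1, add_zero]
    refine intervalIntegral.integral_congr fun s hs ↦ ?_
    rw [uIcc_of_le (by linarith)] at hs
    simp [w, hs.2]
  choose v hv hvint using fun k : ℕ ↦
    exists_integral_period_eq_smul hper hε (t + k * τ) hw hw1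
  have hsum : ∑ k ∈ Finset.range N, τ • v k = ∫ s in t..(t + N * τ), A (s / ε) (w s) := by
    have := intervalIntegral.sum_integral_adjacent_intervals (a := fun k : ℕ ↦ t + k * τ)
      (n := N) (f := fun s ↦ A (s / ε) (w s)) (μ := volume) fun k _ ↦ hwi _ _
    simp only [Nat.cast_zero, zero_mul, add_zero] at this
    rw [← this]
    refine Finset.sum_congr rfl fun k _ ↦ ?_
    rw [← hvint k]
    congr 1
    push_cast
    ring
  refine ⟨∑ k ∈ Finset.range N, (N : ℝ)⁻¹ • v k,
    (convex_periodMeans hA).sum_mem (fun _ _ ↦ by positivity) (by simp [hN0'.ne'])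
      fun k _ ↦ hv k, ?_⟩
  set e := ∑ k ∈ Finset.range N, (N : ℝ)⁻¹ • v k with he
  have he_mem : e ∈ periodMeans A :=
    (convex_periodMeans hA).sum_mem (fun _ _ ↦ by positivity) (by simp [hN0'.ne'])
      fun k _ ↦ hv k
  have h1 : ∫ s in t..(t + h), A (s / ε) (u s) = (N * τ) • e := by
    rw [← hsplit, ← hsum, he, Finset.smul_sum]
    refine Finset.sum_congr rfl fun k _ ↦ ?_
    rw [smul_smul]
    congr 1
    field_simp
  rw [h1, ← sub_smul, norm_smul, Real.norm_of_nonneg (by linarith)]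
  have := norm_le_of_mem_periodMeans hB he_mem
  have hB0 := (norm_nonneg _).trans this
  exact mul_le_mul (by linarith) this (norm_nonneg _) hτ0.le

/-- The difference quotient of an oscillating trajectory near the point `z` is close to a mean
at `z`. -/
theorem exists_mem_periodMeans_norm_quotient_sub_le (hF : IsOscillatingField F B L) (hL0 : 0 ≤ L)
    {ε h : ℝ} (hε : 0 < ε) (hh : 0 < h) {t : ℝ} {u : ℝ → W} (hu : Measurable u)
    (hu1 : ∀ t, ‖u t‖ ≤ 1) {ξ : ℝ → V} (hξ : Continuous ξ)
    (hξe : ξ (t + h) - ξ t = ∫ s in t..(t + h), F (s / ε) (ξ s) (u s)) {z : V} {ρ : ℝ}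
    (hρ : ∀ s ∈ Icc t (t + h), ‖ξ s - z‖ ≤ ρ) :
    ∃ e ∈ periodMeans fun θ ↦ F θ z,
      ‖h⁻¹ • (ξ (t + h) - ξ t) - e‖ ≤ L * ρ + 2 * Real.pi * ε * B / h := by
  obtain ⟨e, he, hle⟩ := exists_mem_periodMeans_norm_integral_sub_le (hF.continuous_angle z)
    (hF.periodic z) (fun θ ↦ hF.bound θ z) hε hh t hu hu1
  refine ⟨e, he, ?_⟩
  have h1 := hF.norm_integral_sub_le hL0 ε hξ (continuous_const (y := z)) hu hu1
    (a := t) (b := t + h) (by linarith) hρ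
  have h2 : h⁻¹ • (ξ (t + h) - ξ t) - e = h⁻¹ • (ξ (t + h) - ξ t - h • e) := by
    rw [smul_sub _ _ (h • e), smul_smul, inv_mul_cancel₀ hh.ne', one_smul]
  rw [h2, norm_smul, norm_inv, Real.norm_of_nonneg hh.le, inv_mul_le_iff₀ hh, hξe]
  refine (norm_sub_le_norm_sub_add_norm_sub _ (∫ s in t..(t + h), F (s / ε) z (u s)) _).trans ?_
  refine (add_le_add h1 hle).trans_eq ?_
  field_simp
  ring

/-- If a curve is approximated by oscillating trajectories of arbitrarily high frequency, then its
derivative, wherever it exists, is a mean. -/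
theorem deriv_mem_periodMeans_of_approx (hF : IsOscillatingField F B L) (hL0 : 0 ≤ L)
    {a b : ℝ} {ζ : ℝ → V} {K : NNReal} (hζ : LipschitzWith K ζ)
    (happrox : ∀ δ > 0, ∃ ε, 0 < ε ∧ ε < δ ∧ ∃ u : ℝ → W, Measurable u ∧ (∀ t, ‖u t‖ ≤ 1) ∧
      ∃ ξ : ℝ → V, Continuous ξ ∧ (∀ s ∈ Icc a b, ‖ξ s - ζ s‖ ≤ δ) ∧
        ∀ s ∈ Icc a b, ∀ t ∈ Icc a b, ξ t - ξ s = ∫ r in s..t, F (r / ε) (ξ r) (u r))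
    {t : ℝ} (ht : t ∈ Ioo a b) {w : V} (hw : HasDerivAt ζ w t) :
    w ∈ periodMeans fun θ ↦ F θ (ζ t) := by
  have hcl := isClosed_periodMeans (hF.continuous_angle (ζ t)) fun θ ↦ hF.bound θ (ζ t)
  rw [← hcl.closure_eq, Metric.mem_closure_iff]
  intro κ hκ
  have hB0 := hF.bound_nonneg
  have hslope : Tendsto (fun h ↦ h⁻¹ • (ζ (t + h) - ζ t)) (𝓝[>] 0) (𝓝 w) :=
    HasDerivAt.tendsto_slope_zero_right hw
  have hsmall : ∀ᶠ h in 𝓝[>] (0 : ℝ), L * (K * h) < κ / 3 := by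
    have : Tendsto (fun h : ℝ ↦ L * (K * h)) (𝓝[>] 0) (𝓝 (L * (K * 0))) :=
      ((continuous_const.mul (continuous_const.mul continuous_id)).tendsto 0).mono_left
        nhdsWithin_le_nhds
    rw [mul_zero, mul_zero] at this
    exact this.eventually_lt_const (by positivity)
  have hb : ∀ᶠ h in 𝓝[>] (0 : ℝ), h < b - t :=
    nhdsWithin_le_nhds (Iio_mem_nhds (by linarith [ht.2]))
  obtain ⟨h, hh1, hh2, hh3, hh0⟩ := ((Metric.tendsto_nhds.1 hslope (κ / 3) (by positivity)).and
    (hsmall.and (hb.and self_mem_nhdsWithin))).exists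
  -- once `h` is fixed, all the errors of the approximation are at most a multiple of `δ`
  let Q : ℝ := L + 2 * Real.pi * B / h + 2 / h + 1
  have hQ0 : 0 < Q := by positivity
  let δ := κ / 3 / Q
  have hδ0 : 0 < δ := by positivity
  obtain ⟨ε, hε0, hεδ, u, hu, hu1, ξ, hξ, hξζ, hξe⟩ := happrox δ hδ0
  have htI : t ∈ Icc a b := ⟨ht.1.le, ht.2.le⟩
  have hthI : t + h ∈ Icc a b := ⟨by linarith [ht.1], by linarith⟩
  obtain ⟨e, he, hle⟩ := hF.exists_mem_periodMeans_norm_quotient_sub_le hL0 hε0 hh0 hu hu1 hξ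
    (hξe t htI (t + h) hthI) (z := ζ t) (ρ := δ + K * h) fun s hs ↦ by
      refine (norm_sub_le_norm_sub_add_norm_sub _ (ζ s) _).trans (add_le_add
        (hξζ s ⟨htI.1.trans hs.1, hs.2.trans hthI.2⟩) ?_)
      rw [← dist_eq_norm]
      refine (hζ.dist_le_mul s t).trans ?_
      gcongr
      rw [Real.dist_eq, abs_of_nonneg (by linarith [hs.1])]
      linarith [hs.2]
  refine ⟨e, he, ?_⟩
  have h1 : ‖h⁻¹ • (ζ (t + h) - ζ t) - h⁻¹ • (ξ (t + h) - ξ t)‖ ≤ 2 / h * δ := by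
    rw [← smul_sub, norm_smul, norm_inv, Real.norm_of_nonneg hh0.le]
    have e1 : ζ (t + h) - ζ t - (ξ (t + h) - ξ t) =
        -(ξ (t + h) - ζ (t + h)) + (ξ t - ζ t) := by abel
    have e2 := norm_add_le (-(ξ (t + h) - ζ (t + h))) (ξ t - ζ t)
    rw [norm_neg, ← e1] at e2
    have e3 := hξζ t htI
    have e4 := hξζ (t + h) hthI
    rw [div_mul_eq_mul_div, inv_mul_eq_div]
    gcongr
    linarith
  have h2 : 2 * Real.pi * ε * B / h ≤ 2 * Real.pi * B / h * δ := by
    rw [div_mul_eq_mul_div]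
    have := mul_le_mul_of_nonneg_left hεδ.le (mul_nonneg Real.two_pi_pos.le hB0)
    gcongr ?_ / h
    linarith
  have h3 : Q * δ = κ / 3 := by simp only [δ]; field_simp
  rw [dist_comm, dist_eq_norm] at hh1
  have h4 := norm_sub_le_norm_sub_add_norm_sub w (h⁻¹ • (ζ (t + h) - ζ t)) e
  have h5 := norm_sub_le_norm_sub_add_norm_sub (h⁻¹ • (ζ (t + h) - ζ t))
    (h⁻¹ • (ξ (t + h) - ξ t)) e
  have h6 : Q * δ = L * δ + 2 * Real.pi * B / h * δ + 2 / h * δ + δ := by simp only [Q]; ring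
  rw [dist_eq_norm]
  have h7 : L * (δ + K * h) = L * δ + L * (K * h) := by ring
  linarith

end IsOscillatingField

end VectorSpace

/-! ### Coordinates of tangent vectors -/

section Coordinates

variable {n : ℕ} {M : Type*} [TopologicalSpace M]
  [ChartedSpace (EuclideanSpace ℝ (Fin n)) M] [IsManifold (𝓡 n) ∞ M]

/-- The coordinates, in the preferred chart at `p`, of the tangent vectors at `x`: for `x` in the
domain of this chart, this is the derivative of the chart at `x`; elsewhere it is zero. -/
noncomputable def toCoord (p x : M) : TangentSpace (𝓡 n) x →L[ℝ] EuclideanSpace ℝ (Fin n) :=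
  (trivializationAt (EuclideanSpace ℝ (Fin n)) (TangentSpace (𝓡 n)) p).continuousLinearMapAt ℝ x

/-- The tangent vector at `x` with given coordinates in the preferred chart at `p`. -/
noncomputable def ofCoord (p x : M) : EuclideanSpace ℝ (Fin n) →L[ℝ] TangentSpace (𝓡 n) x :=
  (trivializationAt (EuclideanSpace ℝ (Fin n)) (TangentSpace (𝓡 n)) p).symmL ℝ x

theorem toCoord_ofCoord {p x : M} (hx : x ∈ (extChartAt (𝓡 n) p).source)
    (w : EuclideanSpace ℝ (Fin n)) : toCoord p x (ofCoord p x w) = w :=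
  Trivialization.continuousLinearMapAt_symmL _ (by simpa using hx) w

theorem ofCoord_toCoord {p x : M} (hx : x ∈ (extChartAt (𝓡 n) p).source)
    (v : TangentSpace (𝓡 n) x) : ofCoord p x (toCoord p x v) = v :=
  Trivialization.symmL_continuousLinearMapAt _ (by simpa using hx) v

theorem mfderiv_apply_one {x : ℝ → M} {t : ℝ} {v : TangentSpace (𝓡 n) (x t)}
    (h : HasMFDerivAt 𝓘(ℝ, ℝ) (𝓡 n) x t ((1 : ℝ →L[ℝ] ℝ).smulRight v)) :
    mfderiv 𝓘(ℝ, ℝ) (𝓡 n) x t (1 : ℝ) = v := by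
  rw [h.mfderiv]
  exact one_smul ℝ v

theorem hasMFDerivAt_smulRight {x : ℝ → M} {t : ℝ}
    (h : MDifferentiableAt 𝓘(ℝ, ℝ) (𝓡 n) x t) :
    HasMFDerivAt 𝓘(ℝ, ℝ) (𝓡 n) x t
      ((1 : ℝ →L[ℝ] ℝ).smulRight (mfderiv 𝓘(ℝ, ℝ) (𝓡 n) x t (1 : ℝ))) := by
  have h3 : mfderiv 𝓘(ℝ, ℝ) (𝓡 n) x t =
      (1 : ℝ →L[ℝ] ℝ).smulRight (mfderiv 𝓘(ℝ, ℝ) (𝓡 n) x t (1 : ℝ)) :=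
    ContinuousLinearMap.ext_ring (one_smul ℝ _).symm
  rw [← h3]
  exact h.hasMFDerivAt

theorem hasDerivAt_chart (p : M) {x : ℝ → M} {t : ℝ}
    (hx : x t ∈ (extChartAt (𝓡 n) p).source) {v : TangentSpace (𝓡 n) (x t)}
    (h : HasMFDerivAt 𝓘(ℝ, ℝ) (𝓡 n) x t ((1 : ℝ →L[ℝ] ℝ).smulRight v)) :
    HasDerivAt (fun s ↦ extChartAt (𝓡 n) p (x s)) (toCoord p (x t) v) t := by
  have hx' : x t ∈ (chartAt (EuclideanSpace ℝ (Fin n)) p).source := by simpa using hx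
  have h1 := (mdifferentiableAt_extChartAt (I := 𝓡 n) hx').hasMFDerivAt
  rw [← TangentBundle.continuousLinearMapAt_trivializationAt hx'] at h1
  have h2 : HasFDerivAt (fun s ↦ extChartAt (𝓡 n) p (x s))
    ((toCoord p (x t)).comp ((1 : ℝ →L[ℝ] ℝ).smulRight v)) t := (h1.comp t h).hasFDerivAt
  have h3 := h2.hasDerivAt
  have h4 : ((toCoord p (x t)).comp ((1 : ℝ →L[ℝ] ℝ).smulRight v)) 1 = toCoord p (x t) v := by
    show toCoord p (x t) ((1 : ℝ) • v) = _
    rw [one_smul]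
  rwa [h4] at h3

theorem hasMFDerivAt_chart_symm (p : M) {ξ : ℝ → EuclideanSpace ℝ (Fin n)} {t : ℝ}
    (hx : ξ t ∈ (extChartAt (𝓡 n) p).target) {w : EuclideanSpace ℝ (Fin n)}
    (h : HasDerivAt ξ w t) :
    HasMFDerivAt 𝓘(ℝ, ℝ) (𝓡 n) (fun s ↦ (extChartAt (𝓡 n) p).symm (ξ s)) t
      ((1 : ℝ →L[ℝ] ℝ).smulRight (ofCoord p ((extChartAt (𝓡 n) p).symm (ξ t)) w)) := by
  have hx' : (extChartAt (𝓡 n) p).symm (ξ t) ∈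
      (chartAt (EuclideanSpace ℝ (Fin n)) p).source := by
    simpa using (extChartAt (𝓡 n) p).map_target hx
  have h1 := (mdifferentiableWithinAt_extChartAt_symm (I := 𝓡 n) hx).hasMFDerivWithinAt
  have h3 := TangentBundle.symmL_trivializationAt (I := 𝓡 n) hx'
  rw [PartialEquiv.right_inv _ hx] at h3
  rw [← h3, modelWithCornersSelf_coe, range_id] at h1
  have h1' : HasMFDerivAt 𝓘(ℝ, EuclideanSpace ℝ (Fin n)) (𝓡 n) (extChartAt (𝓡 n) p).symm (ξ t)
    (ofCoord p ((extChartAt (𝓡 n) p).symm (ξ t))) := hasMFDerivWithinAt_univ.1 h1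
  have h2 := h1'.comp t h.hasFDerivAt.hasMFDerivAt
  have h4 : (1 : ℝ →L[ℝ] ℝ).smulRight (ofCoord p ((extChartAt (𝓡 n) p).symm (ξ t)) w) =
      (ofCoord p ((extChartAt (𝓡 n) p).symm (ξ t))).comp
        (ContinuousLinearMap.toSpanSingleton ℝ w) := by
    ext1
    show (1 : ℝ) • _ = ofCoord p _ ((1 : ℝ) • w)
    rw [one_smul, one_smul]
  rw [h4]
  exact h2

end Coordinates

/-! ### Charts of a Riemannian manifold are locally bi-Lipschitz -/

section Bundle

variable {B : Type*} [TopologicalSpace B] (F : Type*) [NormedAddCommGroup F] [NormedSpace ℝ F]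
  (E : B → Type*) [TopologicalSpace (TotalSpace F E)] [∀ x, NormedAddCommGroup (E x)]
  [∀ x, InnerProductSpace ℝ (E x)] [FiberBundle F E] [VectorBundle ℝ F E]
  [IsContinuousRiemannianBundle F E]

theorem eventually_norm_symmL_trivializationAt_apply_le (x : B) :
    ∃ C > (0 : ℝ), ∀ᶠ y in 𝓝 x, ∀ w : F,
      ‖(trivializationAt F E x).symmL ℝ y w‖ ≤ C * ‖w‖ := by
  obtain ⟨C, hC0, hC⟩ := eventually_norm_symmL_trivializationAt_lt F E x
  exact ⟨C, hC0, hC.mono fun y hy w ↦ (ContinuousLinearMap.le_opNorm _ _).trans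
    (mul_le_mul_of_nonneg_right hy.le (norm_nonneg _))⟩

theorem eventually_norm_trivializationAt_apply_le (x : B) :
    ∃ C > (0 : ℝ), ∀ᶠ y in 𝓝 x, ∀ v : E y,
      ‖(trivializationAt F E x).continuousLinearMapAt ℝ y v‖ ≤ C * ‖v‖ := by
  obtain ⟨C, hC0, hC⟩ := eventually_norm_trivializationAt_lt F E x
  exact ⟨C, hC0, hC.mono fun y hy w ↦ (ContinuousLinearMap.le_opNorm _ _).trans
    (mul_le_mul_of_nonneg_right hy.le (norm_nonneg _))⟩

end Bundle

section Riemannian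

variable {n : ℕ} {M : Type*} [MetricSpace M]
  [ChartedSpace (EuclideanSpace ℝ (Fin n)) M] [IsManifold (𝓡 n) ∞ M]
  [RiemannianBundle (fun x : M ↦ TangentSpace (𝓡 n) x)]

theorem isContinuousRiemannianBundle
    [IsContMDiffRiemannianBundle (𝓡 n) ∞ (EuclideanSpace ℝ (Fin n))
      (fun x : M ↦ TangentSpace (𝓡 n) x)] :
    IsContinuousRiemannianBundle (EuclideanSpace ℝ (Fin n))
      (fun x : M ↦ TangentSpace (𝓡 n) x) := by
  obtain ⟨g, hg, h⟩ := IsContMDiffRiemannianBundle.exists_contMDiff (IB := 𝓡 n) (n := ∞)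
    (F := EuclideanSpace ℝ (Fin n)) (E := fun x : M ↦ TangentSpace (𝓡 n) x)
  exact ⟨⟨g, hg.continuous, h⟩⟩

variable [IsContinuousRiemannianBundle (EuclideanSpace ℝ (Fin n))
    (fun x : M ↦ TangentSpace (𝓡 n) x)] [IsRiemannianManifold (𝓡 n) M]

/-- The inverse of a chart is Lipschitz near the image of its centre: a segment in the chart is a
path in the manifold, of controlled length. -/
theorem exists_lipschitzOnWith_extChartAt_symm (p : M) :
    ∃ (C : NNReal) (r : ℝ), 0 < r ∧
      Metric.ball (extChartAt (𝓡 n) p p) r ⊆ (extChartAt (𝓡 n) p).target ∧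
      LipschitzOnWith C (extChartAt (𝓡 n) p).symm (Metric.ball (extChartAt (𝓡 n) p p) r) := by
  obtain ⟨C, hC0, hC⟩ : ∃ C > (0 : ℝ), ∀ᶠ y in 𝓝 p, ∀ w : EuclideanSpace ℝ (Fin n),
      ‖ofCoord p y w‖ ≤ C * ‖w‖ :=
    eventually_norm_symmL_trivializationAt_apply_le (EuclideanSpace ℝ (Fin n))
      (fun x : M ↦ TangentSpace (𝓡 n) x) p
  lift C to NNReal using hC0.le
  have hN : (extChartAt (𝓡 n) p).target ∩
      (extChartAt (𝓡 n) p).symm ⁻¹'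
        {y | ∀ w : EuclideanSpace ℝ (Fin n), ‖ofCoord p y w‖ ≤ C * ‖w‖} ∈
      𝓝 (extChartAt (𝓡 n) p p) :=
    inter_mem (extChartAt_target_mem_nhds p) (extChartAt_preimage_mem_nhds hC)
  obtain ⟨r, hr0, hr⟩ := Metric.mem_nhds_iff.1 hN
  refine ⟨C, r, hr0, fun ξ hξ ↦ (hr hξ).1, fun ξ hξ ζ hζ ↦ ?_⟩
  let η : ℝ → EuclideanSpace ℝ (Fin n) := fun t ↦ ξ + t • (ζ - ξ)
  let γ : ℝ → M := fun t ↦ (extChartAt (𝓡 n) p).symm (η t)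
  have hη : ∀ t ∈ Icc (0 : ℝ) 1, η t ∈ Metric.ball (extChartAt (𝓡 n) p p) r := fun t ht ↦
    (convex_ball _ _).add_smul_sub_mem hξ hζ ht
  have hηd : ∀ t, HasDerivAt η (ζ - ξ) t := fun t ↦ by
    have := ((hasDerivAt_id t).smul_const (ζ - ξ)).const_add ξ
    rwa [one_smul] at this
  have hγ : ContMDiffOn 𝓘(ℝ, ℝ) (𝓡 n) 1 γ (Icc 0 1) := by
    refine (contMDiffOn_extChartAt_symm p).comp (t := (extChartAt (𝓡 n) p).target) ?_
      fun t ht ↦ (hr (hη t ht)).1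
    rw [contMDiffOn_iff_contDiffOn]
    exact ContDiff.contDiffOn (by fun_prop)
  rw [IsRiemannianManifold.out (I := 𝓡 n)]
  refine (riemannianEDist_le_pathELength hγ (a := 0) (b := 1) (by simp [γ, η]) (by simp [γ, η])
    zero_le_one).trans ?_
  rw [pathELength_eq_lintegral_mfderiv_Icc]
  have hbound : ∀ t ∈ Icc (0 : ℝ) 1, ‖mfderiv 𝓘(ℝ, ℝ) (𝓡 n) γ t 1‖ₑ ≤ C * edist ξ ζ := by
    intro t ht
    have h2 : mfderiv 𝓘(ℝ, ℝ) (𝓡 n) γ t 1 = ofCoord p (γ t) (ζ - ξ) :=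
      mfderiv_apply_one (hasMFDerivAt_chart_symm p (hr (hη t ht)).1 (hηd t))
    rw [h2, edist_comm, edist_eq_enorm_sub, ← ofReal_norm, ← ofReal_norm,
      ← ENNReal.ofReal_coe_nnreal, ← ENNReal.ofReal_mul C.coe_nonneg]
    exact ENNReal.ofReal_le_ofReal ((hr (hη t ht)).2 _)
  refine (setLIntegral_mono' measurableSet_Icc hbound).trans ?_
  simp

/-- A chart is Lipschitz near its centre: a path that is almost minimizing between two points close
to the centre stays close to it, so that its image in the chart has controlled length. -/
theorem exists_lipschitzOnWith_extChartAt (p : M) :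
    ∃ C : NNReal, ∃ U ∈ 𝓝 p, LipschitzOnWith C (extChartAt (𝓡 n) p) U := by
  obtain ⟨C, hC0, hC⟩ : ∃ C > (0 : ℝ), ∀ᶠ y in 𝓝 p, ∀ v : TangentSpace (𝓡 n) y,
      ‖toCoord p y v‖ ≤ C * ‖v‖ :=
    eventually_norm_trivializationAt_apply_le (EuclideanSpace ℝ (Fin n))
      (fun x : M ↦ TangentSpace (𝓡 n) x) p
  lift C to NNReal using hC0.le
  obtain ⟨ρ, hρ0, hρ⟩ := Metric.mem_nhds_iff.1
    (inter_mem hC (extChartAt_source_mem_nhds (I := 𝓡 n) p))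
  refine ⟨C, Metric.ball p (ρ / 3), Metric.ball_mem_nhds p (by positivity), fun y hy z hz ↦ ?_⟩
  have hyz : edist y z < ENNReal.ofReal (2 * ρ / 3) := by
    rw [edist_dist, ENNReal.ofReal_lt_ofReal_iff (by positivity)]
    have := dist_triangle_right y z p
    rw [Metric.mem_ball] at hy hz
    linarith
  -- it suffices to compare with the length of a path of length `< R`, for `R` close to `edist y z`
  have key : ∀ R : ENNReal, edist y z < R → R ≤ ENNReal.ofReal (2 * ρ / 3) →
      edist (extChartAt (𝓡 n) p y) (extChartAt (𝓡 n) p z) ≤ C * R := by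
    intro R hR hRρ
    rw [IsRiemannianManifold.out (I := 𝓡 n)] at hR
    obtain ⟨γ, hγ0, hγ1, hγ, hlen, -⟩ :=
      exists_lt_locally_constant_of_riemannianEDist_lt hR zero_lt_one
    have hstay : ∀ t ∈ Icc (0 : ℝ) 1, γ t ∈ Metric.ball p ρ := by
      intro t ht
      have h1 : edist y (γ t) < ENNReal.ofReal (2 * ρ / 3) := by
        rw [IsRiemannianManifold.out (I := 𝓡 n)]
        refine lt_of_lt_of_le (lt_of_le_of_lt ?_ hlen) hRρ
        exact (riemannianEDist_le_pathELength hγ.contMDiffOn hγ0 rfl ht.1).trans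
          (pathELength_mono le_rfl ht.2)
      rw [edist_dist, ENNReal.ofReal_lt_ofReal_iff (by positivity)] at h1
      have h2 := dist_triangle (γ t) y p
      rw [Metric.mem_ball] at hy ⊢
      rw [dist_comm] at h1
      linarith
    have hcd : ContDiffOn ℝ 1 (fun t ↦ extChartAt (𝓡 n) p (γ t)) (Icc 0 1) := by
      rw [← contMDiffOn_iff_contDiffOn]
      refine (contMDiffOn_extChartAt (x := p) (n := 1) (I := 𝓡 n)).comp
        (t := (chartAt (EuclideanSpace ℝ (Fin n)) p).source) hγ.contMDiffOn fun t ht ↦ ?_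
      simpa using (hρ (hstay t ht)).2
    have h1 := enorm_sub_le_lintegral_derivWithin_Icc_of_contDiffOn_Icc hcd zero_le_one
    rw [← hγ0, ← hγ1, edist_comm, edist_eq_enorm_sub]
    refine h1.trans ?_
    have hbound : ∀ t ∈ Icc (0 : ℝ) 1,
        ‖derivWithin (fun t ↦ extChartAt (𝓡 n) p (γ t)) (Icc 0 1) t‖ₑ ≤
          C * ‖mfderiv 𝓘(ℝ, ℝ) (𝓡 n) γ t 1‖ₑ := by
      intro t ht
      have h2 := hasMFDerivAt_smulRight ((hγ.mdifferentiable one_ne_zero) t)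
      have h4 := (hasDerivAt_chart p (hρ (hstay t ht)).2 h2).hasDerivWithinAt (s := Icc 0 1)
      rw [h4.derivWithin (uniqueDiffOn_Icc zero_lt_one t ht), ← ofReal_norm, ← ofReal_norm,
        ← ENNReal.ofReal_coe_nnreal, ← ENNReal.ofReal_mul C.coe_nonneg]
      exact ENNReal.ofReal_le_ofReal ((hρ (hstay t ht)).1 _)
    refine (setLIntegral_mono' measurableSet_Icc hbound).trans ?_
    rw [lintegral_const_mul' _ _ ENNReal.coe_ne_top, ← pathELength_eq_lintegral_mfderiv_Icc]
    gcongr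
  have hlim : Tendsto (fun R : ENNReal ↦ C * R) (𝓝[>] edist y z) (𝓝 (C * edist y z)) :=
    ((ENNReal.continuous_const_mul ENNReal.coe_ne_top).tendsto _).mono_left nhdsWithin_le_nhds
  have : (𝓝[>] edist y z).NeBot := nhdsGT_neBot_of_exists_gt ⟨_, hyz⟩
  refine ge_of_tendsto hlim ?_
  filter_upwards [Ioc_mem_nhdsGT hyz] with R hR using key R hR.1 hR.2

end Riemannian

/-! ### Fields in a chart -/

/-- A family of `C¹` fields, periodic in the angle and defined near a closed ball, agrees on the
ball of half the radius with a globally Lipschitz oscillating field, obtained by composition with a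
smooth map of the space into the closed ball that fixes the smaller ball. -/
theorem exists_isOscillatingField {m : ℕ} {V : Type*} [NormedAddCommGroup V]
    [InnerProductSpace ℝ V] [FiniteDimensional ℝ V] {f : Fin m → ℝ → V → V} {s : Set V} {c : V}
    {R : ℝ} (hR : 0 < R) (hs : Metric.closedBall c R ⊆ s)
    (hf : ∀ i, ContDiffOn ℝ 1 (fun q : ℝ × V ↦ f i q.1 q.2) (univ ×ˢ s))
    (hper : ∀ i, ∀ ξ ∈ s, Function.Periodic (fun θ ↦ f i θ ξ) (2 * Real.pi)) :
    ∃ (F : ℝ → V → EuclideanSpace ℝ (Fin m) →L[ℝ] V) (B L : ℝ), 0 ≤ L ∧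
      IsOscillatingField F B L ∧
      ∀ ξ ∈ Metric.ball c (R / 2), ∀ θ u, F θ ξ u = ∑ i, u i • f i θ ξ := by
  classical
  let χ : ContDiffBump c := ⟨R / 2, R, by positivity, by linarith⟩
  let ρ : V → V := fun ξ ↦ c + χ ξ • (ξ - c)
  have hρmem : ∀ ξ, ρ ξ ∈ Metric.closedBall c R := fun ξ ↦ by
    rw [Metric.mem_closedBall, dist_eq_norm]
    simp only [ρ, add_sub_cancel_left]
    rw [norm_smul, Real.norm_of_nonneg χ.nonneg]
    by_cases hξ : dist ξ c < R
    · rw [dist_eq_norm] at hξ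
      nlinarith [χ.le_one (x := ξ), χ.nonneg (x := ξ), norm_nonneg (ξ - c)]
    · rw [χ.zero_of_le_dist (not_lt.1 hξ)]
      simpa using hR.le
  have hρid : ∀ ξ ∈ Metric.ball c (R / 2), ρ ξ = ξ := fun ξ hξ ↦ by
    simp only [ρ]
    rw [χ.one_of_mem_closedBall (Metric.ball_subset_closedBall hξ), one_smul, add_sub_cancel]
  have hρsm : ContDiff ℝ 1 fun ξ ↦ χ ξ • (ξ - c) :=
    χ.contDiff.smul (contDiff_id.sub contDiff_const)
  obtain ⟨Kρ, hKρ⟩ : ∃ K, LipschitzWith K ρ := by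
    obtain ⟨K, hK⟩ := ContDiff.lipschitzWith_of_hasCompactSupport
      (χ.hasCompactSupport.smul_right (f' := fun ξ ↦ ξ - c)) hρsm one_ne_zero
    refine ⟨K, LipschitzWith.of_dist_le_mul fun x y ↦ ?_⟩
    simpa [ρ] using hK.dist_le_mul x y
  have hρc : Continuous ρ := hKρ.continuous
  -- Lipschitz and sup bounds on the compact set `[0, 2π] × closedBall c R`
  let Q : Set (ℝ × V) := Icc 0 (2 * Real.pi) ×ˢ Metric.closedBall c R
  have hQ : IsCompact Q := isCompact_Icc.prod (isCompact_closedBall c R)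
  have hQs : Q ⊆ univ ×ˢ s := fun q hq ↦ ⟨mem_univ _, hs hq.2⟩
  have hQc : Convex ℝ Q := (convex_Icc _ _).prod (convex_closedBall _ _)
  choose K hK using fun i ↦ ((hf i).mono hQs).exists_lipschitzOnWith one_ne_zero hQc hQ
  choose b hb using fun i ↦ hQ.exists_bound_of_continuousOn ((hf i).continuousOn.mono hQs)
  have hθ : ∀ θ : ℝ, ∃ θ' ∈ Icc (0 : ℝ) (2 * Real.pi), ∀ i, ∀ ξ ∈ s, f i θ ξ = f i θ' ξ := by
    intro θ
    refine ⟨toIcoMod Real.two_pi_pos 0 θ, ?_, fun i ξ hξ ↦ ?_⟩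
    · have := toIcoMod_mem_Ico Real.two_pi_pos 0 θ
      rw [zero_add] at this
      exact Ico_subset_Icc_self this
    · have h1 := (hper i ξ hξ).sub_zsmul_eq (x := θ) (toIcoDiv Real.two_pi_pos 0 θ)
      exact h1.symm
  have hlip : ∀ i θ ξ η, ‖f i θ (ρ ξ) - f i θ (ρ η)‖ ≤ K i * (Kρ * ‖ξ - η‖) := by
    intro i θ ξ η
    obtain ⟨θ', hθ', he⟩ := hθ θ
    rw [he i _ (hs (hρmem ξ)), he i _ (hs (hρmem η)), ← dist_eq_norm]
    refine ((hK i).dist_le_mul (θ', ρ ξ) ⟨hθ', hρmem ξ⟩ (θ', ρ η) ⟨hθ', hρmem η⟩).trans ?_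
    gcongr
    rw [Prod.dist_eq, dist_self, max_eq_right dist_nonneg, ← dist_eq_norm]
    exact hKρ.dist_le_mul ξ η
  have hbd : ∀ i θ ξ, ‖f i θ (ρ ξ)‖ ≤ b i := by
    intro i θ ξ
    obtain ⟨θ', hθ', he⟩ := hθ θ
    rw [he i _ (hs (hρmem ξ))]
    exact hb i (θ', ρ ξ) ⟨hθ', hρmem ξ⟩
  let P : Fin m → EuclideanSpace ℝ (Fin m) →L[ℝ] ℝ := fun i ↦ EuclideanSpace.proj i
  let F : ℝ → V → EuclideanSpace ℝ (Fin m) →L[ℝ] V := fun θ ξ ↦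
    ∑ i, (P i).smulRight (f i θ (ρ ξ))
  refine ⟨F, ∑ i, ‖P i‖ * b i, ∑ i, ‖P i‖ * (K i * Kρ), by positivity,
    ⟨?_, ?_, fun θ ξ ↦ ?_, fun θ ξ η ↦ ?_⟩, fun ξ hξ θ u ↦ ?_⟩
  · refine continuous_finsetSum _ fun i _ ↦ ?_
    have h1 : Continuous fun q : ℝ × V ↦ f i q.1 (ρ q.2) :=
      (hf i).continuousOn.comp_continuous (f := fun q : ℝ × V ↦ (q.1, ρ q.2))
        (continuous_fst.prodMk (hρc.comp continuous_snd)) fun q ↦ ⟨mem_univ _, hs (hρmem _)⟩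
    exact (ContinuousLinearMap.smulRightL ℝ _ V (P i)).continuous.comp h1
  · intro ξ θ
    simp only [F]
    exact Finset.sum_congr rfl fun i _ ↦ congrArg (P i).smulRight (hper i _ (hs (hρmem ξ)) θ)
  · refine (norm_sum_le _ _).trans (Finset.sum_le_sum fun i _ ↦ ?_)
    rw [ContinuousLinearMap.norm_smulRight_apply]
    exact mul_le_mul_of_nonneg_left (hbd i θ ξ) (norm_nonneg _)
  · simp only [F]
    rw [← Finset.sum_sub_distrib, Finset.sum_mul]
    refine (norm_sum_le _ _).trans (Finset.sum_le_sum fun i _ ↦ ?_)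
    have h1 : (P i).smulRight (f i θ (ρ ξ)) - (P i).smulRight (f i θ (ρ η)) =
        (P i).smulRight (f i θ (ρ ξ) - f i θ (ρ η)) := by
      ext u; simp [smul_sub]
    rw [h1, ContinuousLinearMap.norm_smulRight_apply, mul_assoc, mul_assoc]
    exact mul_le_mul_of_nonneg_left (hlip i θ ξ η) (norm_nonneg _)
  · simp only [F, P, hρid ξ hξ, sum_apply, ContinuousLinearMap.smulRight_apply]
    rfl

section Chart

variable {m n : ℕ} {M : Type*}

theorem contDiffOn_chart_field [TopologicalSpace M] [ChartedSpace (EuclideanSpace ℝ (Fin n)) M]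
    [IsManifold (𝓡 n) ∞ M] (G : OscillatingFields m n M) (p : M) (i : Fin m) :
    ContDiffOn ℝ 1 (fun q : ℝ × EuclideanSpace ℝ (Fin n) ↦
      toCoord p ((extChartAt (𝓡 n) p).symm q.2)
        (G.field i q.1 ((extChartAt (𝓡 n) p).symm q.2)))
      (univ ×ˢ (extChartAt (𝓡 n) p).target) := by
  let e := trivializationAt (EuclideanSpace ℝ (Fin n)) (TangentSpace (𝓡 n) (M := M)) p
  have h1 : ContMDiffOn (𝓘(ℝ, ℝ).prod 𝓘(ℝ, EuclideanSpace ℝ (Fin n))) (𝓘(ℝ, ℝ).prod (𝓡 n)) 1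
      (fun q : ℝ × EuclideanSpace ℝ (Fin n) ↦ (q.1, (extChartAt (𝓡 n) p).symm q.2))
      (univ ×ˢ (extChartAt (𝓡 n) p).target) :=
    contMDiffOn_fst.prodMk ((contMDiffOn_extChartAt_symm p).comp contMDiffOn_snd fun q hq ↦ hq.2)
  have h2 := ((G.smooth i).of_le (m := 1) (by simp)).comp_contMDiffOn h1
  have hbase : ∀ q ∈ (univ : Set ℝ) ×ˢ (extChartAt (𝓡 n) p).target,
      (extChartAt (𝓡 n) p).symm q.2 ∈ e.baseSet := fun q hq ↦ by
    simpa [e] using (extChartAt (𝓡 n) p).map_target hq.2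
  have h3 := ((e.contMDiffOn_iff fun q hq ↦ e.mem_source.2 (hbase q hq)).1 h2).2
  rw [← contMDiffOn_iff_contDiffOn, modelWithCornersSelf_prod, ← chartedSpaceSelf_prod]
  refine h3.congr fun q hq ↦ ?_
  exact e.continuousLinearMapAt_apply_of_mem (R := ℝ) (hbase q hq) _

variable [MetricSpace M] [ChartedSpace (EuclideanSpace ℝ (Fin n)) M] [IsManifold (𝓡 n) ∞ M]

/-- A description of the oscillating system `G` near `p` in the preferred chart `φ` at `p`: on the
ball of radius `r` around `φ p`, on which the chart is bi-Lipschitz with constant `C`, the system is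
given by the globally defined oscillating field `F`. -/
structure LocalModel (G : OscillatingFields m n M) (p : M) where
  /-- the field in the chart -/
  F : ℝ → EuclideanSpace ℝ (Fin n) → EuclideanSpace ℝ (Fin m) →L[ℝ] EuclideanSpace ℝ (Fin n)
  /-- the bound of the field -/
  B : ℝ
  /-- the Lipschitz constant of the field -/
  L : ℝ
  /-- the Lipschitz constant of the chart and of its inverse -/
  C : NNReal
  /-- the radius of the ball -/
  r : ℝ
  L_nonneg : 0 ≤ L
  isField : IsOscillatingField F B L
  r_pos : 0 < r
  ball_subset : Metric.ball (extChartAt (𝓡 n) p p) r ⊆ (extChartAt (𝓡 n) p).target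
  F_eq : ∀ x ∈ (extChartAt (𝓡 n) p).source,
    extChartAt (𝓡 n) p x ∈ Metric.ball (extChartAt (𝓡 n) p p) r →
    ∀ θ u, F θ (extChartAt (𝓡 n) p x) u = toCoord p x (G.apply θ x u)
  lip_symm : LipschitzOnWith C (extChartAt (𝓡 n) p).symm (Metric.ball (extChartAt (𝓡 n) p p) r)
  lip : LipschitzOnWith C (extChartAt (𝓡 n) p)
    ((extChartAt (𝓡 n) p).source ∩
      extChartAt (𝓡 n) p ⁻¹' Metric.ball (extChartAt (𝓡 n) p p) r)

theorem nonempty_localModel [RiemannianBundle (fun x : M ↦ TangentSpace (𝓡 n) x)]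
    [IsContinuousRiemannianBundle (EuclideanSpace ℝ (Fin n))
      (fun x : M ↦ TangentSpace (𝓡 n) x)] [IsRiemannianManifold (𝓡 n) M]
    (G : OscillatingFields m n M) (p : M) : Nonempty (LocalModel G p) := by
  obtain ⟨C₁, r₁, hr₁, hsub, hC₁⟩ := exists_lipschitzOnWith_extChartAt_symm (n := n) p
  obtain ⟨C₂, U, hU, hC₂⟩ := exists_lipschitzOnWith_extChartAt (n := n) p
  obtain ⟨r₂, hr₂, hU₂⟩ := Metric.mem_nhds_iff.1 (extChartAt_preimage_mem_nhds (I := 𝓡 n) hU)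
  let R := min r₁ r₂ / 2
  have hR : 0 < R := by positivity
  have hR₁ : R < r₁ := by
    have := min_le_left r₁ r₂
    simp only [R]; linarith
  have hR₂ : R < r₂ := by
    have := min_le_right r₁ r₂
    simp only [R]; linarith
  have hRs : Metric.closedBall (extChartAt (𝓡 n) p p) R ⊆ (extChartAt (𝓡 n) p).target :=
    (Metric.closedBall_subset_ball hR₁).trans hsub
  obtain ⟨F, B, L, hL, hF, hFe⟩ := exists_isOscillatingField hR hRs
    (f := fun i θ ξ ↦ toCoord p ((extChartAt (𝓡 n) p).symm ξ)
      (G.field i θ ((extChartAt (𝓡 n) p).symm ξ)))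
    (contDiffOn_chart_field G p) fun i ξ _ θ ↦ by simp only [G.periodic]
  refine ⟨⟨F, B, L, max C₁ C₂, R / 2, hL, hF, by positivity,
    (Metric.ball_subset_ball (by linarith)).trans hsub, fun x hx hxb θ u ↦ ?_,
    (hC₁.mono (Metric.ball_subset_ball (by linarith))).weaken (le_max_left _ _),
    (hC₂.mono fun x hx ↦ ?_).weaken (le_max_right _ _)⟩⟩
  · rw [hFe _ hxb, (extChartAt (𝓡 n) p).left_inv hx, OscillatingFields.apply, map_sum]
    exact Finset.sum_congr rfl fun i _ ↦ ((toCoord p x).map_smul _ _).symm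
  · have := hU₂ (Metric.ball_subset_ball (by linarith) hx.2)
    rwa [mem_preimage, (extChartAt (𝓡 n) p).left_inv hx.1] at this

end Chart

/-! ### Absolutely continuous curves with bounded velocity -/

theorem absolutelyContinuousOnInterval_comp {X Y : Type*} [PseudoMetricSpace X]
    [PseudoMetricSpace Y] {f : X → Y} {C : NNReal} {s : Set X} (hf : LipschitzOnWith C f s)
    {x : ℝ → X} {a b : ℝ} (hx : AbsolutelyContinuousOnInterval x a b)
    (hmem : ∀ t ∈ uIcc a b, x t ∈ s) : AbsolutelyContinuousOnInterval (fun t ↦ f (x t)) a b := by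
  rw [absolutelyContinuousOnInterval_iff] at hx ⊢
  intro ε hε
  obtain ⟨δ, hδ, h⟩ := hx (ε / (C + 1)) (by positivity)
  refine ⟨δ, hδ, fun E hE hlen ↦ ?_⟩
  calc ∑ i ∈ Finset.range E.1, dist (f (x (E.2 i).1)) (f (x (E.2 i).2))
      ≤ ∑ i ∈ Finset.range E.1, C * dist (x (E.2 i).1) (x (E.2 i).2) :=
        Finset.sum_le_sum fun i hi ↦ hf.dist_le_mul _ (hmem _ (hE.1 i hi).1) _
          (hmem _ (hE.1 i hi).2)
    _ = C * ∑ i ∈ Finset.range E.1, dist (x (E.2 i).1) (x (E.2 i).2) := by rw [Finset.mul_sum]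
    _ ≤ (C + 1) * ∑ i ∈ Finset.range E.1, dist (x (E.2 i).1) (x (E.2 i).2) := by
        gcongr
        simp
    _ < (C + 1) * (ε / (C + 1)) := mul_lt_mul_of_pos_left (h E hE hlen) (by positivity)
    _ = ε := by field_simp

theorem continuousOn_of_absolutelyContinuousOnInterval {X : Type*} [PseudoMetricSpace X]
    {x : ℝ → X} {a b : ℝ} (hx : AbsolutelyContinuousOnInterval x a b) :
    ContinuousOn x (uIcc a b) := by
  rw [absolutelyContinuousOnInterval_iff] at hx
  refine Metric.continuousOn_iff.2 fun t ht ε hε ↦ ?_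
  obtain ⟨δ, hδ, h⟩ := hx ε hε
  refine ⟨δ, hδ, fun s hs hst ↦ ?_⟩
  have := h (1, fun _ ↦ (s, t)) ⟨fun _ _ ↦ ⟨hs, ht⟩, by simp [Set.PairwiseDisjoint]⟩
  simpa using this (by simpa using hst)

theorem norm_integral_le_mul_sub {V : Type*} [NormedAddCommGroup V] [NormedSpace ℝ V] {g : ℝ → V}
    {a b K : ℝ} (hgK : ∀ᵐ t, t ∈ Ioo a b → ‖g t‖ ≤ K) {s t : ℝ} (hs : s ∈ Icc a b)
    (ht : t ∈ Icc a b) : ‖∫ r in s..t, g r‖ ≤ K * |t - s| := by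
  refine intervalIntegral.norm_integral_le_of_norm_le_const_ae ?_
  have hne : ∀ᵐ r : ℝ, r ≠ b := by simp [ae_iff, measure_singleton]
  filter_upwards [hgK, hne] with r hr hrb hmem
  obtain ⟨h1, h2⟩ := hmem
  refine hr ⟨lt_of_le_of_lt (le_min hs.1 ht.1) h1, lt_of_le_of_ne (h2.trans (max_le hs.2 ht.2)) hrb⟩

/-- The fundamental theorem of calculus for an absolutely continuous curve in a vector space whose
velocity is bounded. -/
theorem intervalIntegrable_and_sub_eq_integral {V : Type*} [NormedAddCommGroup V]
    [NormedSpace ℝ V] [CompleteSpace V] [SecondCountableTopology V] {f g : ℝ → V} {a b K : ℝ}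
    (hab : a ≤ b) (hf : AbsolutelyContinuousOnInterval f a b)
    (hd : ∀ᵐ t, t ∈ Ioo a b → HasDerivAt f (g t) t) (hgK : ∀ᵐ t, t ∈ Ioo a b → ‖g t‖ ≤ K) :
    IntervalIntegrable g volume a b ∧
      ∀ s ∈ Icc a b, ∀ t ∈ Icc a b, f t - f s = ∫ r in s..t, g r := by
  have hg : IntervalIntegrable g volume a b := by
    rw [intervalIntegrable_iff_integrableOn_Ioo_of_le hab]
    refine Integrable.of_bound (C := K) ?_ ((ae_restrict_iff' measurableSet_Ioo).2 hgK)
    refine (stronglyMeasurable_deriv f).aestronglyMeasurable.congr ?_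
    rw [EventuallyEq, ae_restrict_iff' measurableSet_Ioo]
    exact hd.mono fun t ht htI ↦ (ht htI).deriv
  refine ⟨hg, ?_⟩
  have hsub : ∀ s ∈ Icc a b, ∀ t ∈ Icc a b, IntervalIntegrable g volume s t := fun s hs t ht ↦
    hg.mono_set (by rw [uIcc_of_le hab]; exact uIcc_subset_Icc hs ht)
  let P : ℝ → V := fun t ↦ ∫ r in a..t, g r
  have hP : ∀ s ∈ Icc a b, ∀ t ∈ Icc a b, P t - P s = ∫ r in s..t, g r := fun s hs t ht ↦
    intervalIntegral.integral_interval_sub_left (hsub a ⟨le_rfl, hab⟩ t ht)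
      (hsub a ⟨le_rfl, hab⟩ s hs)
  have hPac : AbsolutelyContinuousOnInterval P a b := by
    have : LipschitzOnWith K.toNNReal P (uIcc a b) := by
      refine LipschitzOnWith.of_dist_le_mul fun t ht s hs ↦ ?_
      rw [uIcc_of_le hab] at ht hs
      rw [dist_eq_norm, hP s hs t ht, Real.dist_eq]
      exact (norm_integral_le_mul_sub hgK hs ht).trans
        (mul_le_mul_of_nonneg_right (Real.le_coe_toNNReal K) (abs_nonneg _))
    exact this.absolutelyContinuousOnInterval
  have hzero : ∀ᵐ t, t ∈ uIcc a b → HasDerivAt (f - P) 0 t := by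
    have hne : ∀ᵐ r : ℝ, r ≠ b := by simp [ae_iff, measure_singleton]
    have hne' : ∀ᵐ r : ℝ, r ≠ a := by simp [ae_iff, measure_singleton]
    filter_upwards [hd, hg.ae_hasDerivAt_integral, hne, hne'] with t h1 h2 hb ha ht
    have ht' := ht
    rw [uIcc_of_le hab] at ht'
    have := (h1 ⟨lt_of_le_of_ne ht'.1 ha.symm, lt_of_le_of_ne ht'.2 hb⟩).sub
      (h2 ht a left_mem_uIcc)
    rwa [sub_self] at this
  obtain ⟨c, hc⟩ := (hf.sub hPac).const_of_ae_hasDerivAt_zero hzero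
  rw [uIcc_of_le hab] at hc
  intro s hs t ht
  rw [← hP s hs t ht, sub_eq_sub_iff_sub_eq_sub]
  exact (hc t ht).trans (hc s hs).symm

theorem exists_lipschitzWith_eqOn_Icc {X : Type*} [PseudoMetricSpace X] {a b : ℝ} (hab : a ≤ b)
    {f : ℝ → X} {K : NNReal} (hf : LipschitzOnWith K f (Icc a b)) :
    ∃ f' : ℝ → X, LipschitzWith K f' ∧ EqOn f' f (Icc a b) := by
  refine ⟨IccExtend hab ((Icc a b).domRestrict f), ?_, fun t ht ↦ IccExtend_of_mem hab _ ht⟩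
  have := hf.to_restrict.comp (LipschitzWith.projIcc hab)
  rwa [mul_one] at this

/-! ### Trajectories on subintervals -/

section Trajectories

variable {m n : ℕ} {M : Type*} [MetricSpace M] [ChartedSpace (EuclideanSpace ℝ (Fin n)) M]
  [IsManifold (𝓡 n) ∞ M]

/-- The curve `x` solves the oscillating system with control `u` on `[a, b]`. The equation is
imposed at almost all interior times, where derivatives are two-sided: this makes the notion local
in time. -/
def IsTrajectory (G : OscillatingFields m n M) (ε : ℝ) (u : ℝ → EuclideanSpace ℝ (Fin m))
    (x : ℝ → M) (a b : ℝ) : Prop :=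
  AbsolutelyContinuousOnInterval x a b ∧ ∀ᵐ t, t ∈ Ioo a b →
    HasMFDerivAt 𝓘(ℝ, ℝ) (𝓡 n) x t ((1 : ℝ →L[ℝ] ℝ).smulRight (G.apply (t / ε) (x t) (u t)))

/-- The curve `x` solves the average differential inclusion on `[a, b]`. -/
def IsAverageTrajectory (G : OscillatingFields m n M) (x : ℝ → M) (a b : ℝ) : Prop :=
  AbsolutelyContinuousOnInterval x a b ∧ ∀ᵐ t, t ∈ Ioo a b → ∃ v ∈ G.velocitySet (x t),
    HasMFDerivAt 𝓘(ℝ, ℝ) (𝓡 n) x t ((1 : ℝ →L[ℝ] ℝ).smulRight v)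

theorem isSolution_iff (G : OscillatingFields m n M) (ε T : ℝ)
    (u : ℝ → EuclideanSpace ℝ (Fin m)) (x : ℝ → M) :
    G.IsSolution ε T u x ↔ IsTrajectory G ε u x 0 T := by
  rw [OscillatingFields.IsSolution, IsTrajectory, ← Measure.restrict_congr_set Ioo_ae_eq_Icc,
    ae_restrict_iff' measurableSet_Ioo]
  refine and_congr_right fun _ ↦ eventually_congr (Eventually.of_forall fun t ↦ ?_)
  exact forall_congr' fun ht ↦ ⟨fun h ↦ h.hasMFDerivAt (Icc_mem_nhds ht.1 ht.2),
    fun h ↦ h.hasMFDerivWithinAt⟩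

theorem isAverageSolution_iff (G : OscillatingFields m n M) (T : ℝ) (x : ℝ → M) :
    G.IsAverageSolution T x ↔ IsAverageTrajectory G x 0 T := by
  rw [OscillatingFields.IsAverageSolution, IsAverageTrajectory,
    ← Measure.restrict_congr_set Ioo_ae_eq_Icc, ae_restrict_iff' measurableSet_Ioo]
  refine and_congr_right fun _ ↦ eventually_congr (Eventually.of_forall fun t ↦ ?_)
  exact forall_congr' fun ht ↦ exists_congr fun v ↦ and_congr_right fun _ ↦
    ⟨fun h ↦ h.hasMFDerivAt (Icc_mem_nhds ht.1 ht.2), fun h ↦ h.hasMFDerivWithinAt⟩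

variable {G : OscillatingFields m n M} {ε : ℝ} {u : ℝ → EuclideanSpace ℝ (Fin m)} {x : ℝ → M}
  {a b c d : ℝ}

theorem IsTrajectory.mono (h : IsTrajectory G ε u x a b) (hac : a ≤ c) (hcd : c ≤ d)
    (hdb : d ≤ b) : IsTrajectory G ε u x c d := by
  refine ⟨h.1.mono ?_, ?_⟩
  · rw [uIcc_of_le hcd, uIcc_of_le (hac.trans (hcd.trans hdb))]
    exact Icc_subset_Icc hac hdb
  · filter_upwards [h.2] with t ht hI using ht ⟨hac.trans_lt hI.1, hI.2.trans_le hdb⟩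

theorem IsAverageTrajectory.mono (h : IsAverageTrajectory G x a b) (hac : a ≤ c) (hcd : c ≤ d)
    (hdb : d ≤ b) : IsAverageTrajectory G x c d := by
  refine ⟨h.1.mono ?_, ?_⟩
  · rw [uIcc_of_le hcd, uIcc_of_le (hac.trans (hcd.trans hdb))]
    exact Icc_subset_Icc hac hdb
  · filter_upwards [h.2] with t ht hI using ht ⟨hac.trans_lt hI.1, hI.2.trans_le hdb⟩

theorem IsTrajectory.continuousOn (h : IsTrajectory G ε u x a b) (hab : a ≤ b) :
    ContinuousOn x (Icc a b) := by
  have := continuousOn_of_absolutelyContinuousOnInterval h.1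
  rwa [uIcc_of_le hab] at this

theorem IsAverageTrajectory.continuousOn (h : IsAverageTrajectory G x a b) (hab : a ≤ b) :
    ContinuousOn x (Icc a b) := by
  have := continuousOn_of_absolutelyContinuousOnInterval h.1
  rwa [uIcc_of_le hab] at this

end Trajectories

/-! ### Trajectories in a chart -/

namespace LocalModel

variable {m n : ℕ} {M : Type*} [MetricSpace M] [ChartedSpace (EuclideanSpace ℝ (Fin n)) M]
  [IsManifold (𝓡 n) ∞ M] {G : OscillatingFields m n M} {p : M}

/-- The part of the manifold described by the local model. -/
def dom (D : LocalModel G p) : Set M :=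
  (extChartAt (𝓡 n) p).source ∩ extChartAt (𝓡 n) p ⁻¹' Metric.ball (extChartAt (𝓡 n) p p) D.r

variable (D : LocalModel G p)

theorem isOpen_dom : IsOpen D.dom :=
  isOpen_extChartAt_preimage' p Metric.isOpen_ball

theorem mem_dom : p ∈ D.dom :=
  ⟨mem_extChartAt_source p, Metric.mem_ball_self D.r_pos⟩

theorem symm_mem_dom {ξ : EuclideanSpace ℝ (Fin n)}
    (hξ : ξ ∈ Metric.ball (extChartAt (𝓡 n) p p) D.r) : (extChartAt (𝓡 n) p).symm ξ ∈ D.dom :=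
  ⟨(extChartAt (𝓡 n) p).map_target (D.ball_subset hξ), by
    rwa [mem_preimage, (extChartAt (𝓡 n) p).right_inv (D.ball_subset hξ)]⟩

/-- In the chart, the vectors of the velocity set are the means of the field. -/
theorem mem_velocitySet_iff {x : M} (hx : x ∈ D.dom) (v : TangentSpace (𝓡 n) x) :
    v ∈ G.velocitySet x ↔
      toCoord p x v ∈ periodMeans fun θ ↦ D.F θ (extChartAt (𝓡 n) p x) := by
  have hav : ∀ U : ℝ → EuclideanSpace ℝ (Fin m), Measurable U → (∀ θ, ‖U θ‖ ≤ 1) →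
      G.average x U = ofCoord p x ((2 * Real.pi)⁻¹ •
        ∫ θ in (0 : ℝ)..(2 * Real.pi), D.F θ (extChartAt (𝓡 n) p x) (U θ)) := by
    intro U hU hU1
    -- the tangent space is the fixed vector space `ℝⁿ`
    let A : EuclideanSpace ℝ (Fin n) →L[ℝ] EuclideanSpace ℝ (Fin n) := ofCoord p x
    have h1 := A.intervalIntegral_comp_comm (intervalIntegrable_apply
      (D.isField.continuous_angle (extChartAt (𝓡 n) p x)) hU hU1 0 (2 * Real.pi))
    have h2 : (fun θ ↦ A (D.F θ (extChartAt (𝓡 n) p x) (U θ))) = fun θ ↦ G.apply θ x (U θ) := by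
      funext θ
      rw [D.F_eq x hx.1 hx.2]
      exact ofCoord_toCoord hx.1 _
    have h3 : ofCoord p x ((2 * Real.pi)⁻¹ •
        ∫ θ in (0 : ℝ)..(2 * Real.pi), D.F θ (extChartAt (𝓡 n) p x) (U θ)) =
        (2 * Real.pi)⁻¹ • A (∫ θ in (0 : ℝ)..(2 * Real.pi),
          D.F θ (extChartAt (𝓡 n) p x) (U θ)) := A.map_smul _ _
    rw [h3, ← h1, h2]
    rfl
  constructor
  · rintro ⟨U, hU, hU1, rfl⟩
    obtain ⟨U', hU', hU1', hae⟩ := exists_measurable_norm_le_one hU hU1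
    have h1 : G.average x U = G.average x U' := by
      unfold OscillatingFields.average
      refine congrArg (fun y : EuclideanSpace ℝ (Fin n) ↦ (2 * Real.pi)⁻¹ • y) ?_
      refine intervalIntegral.integral_congr_ae ?_
      rw [EventuallyEq, ae_restrict_iff' measurableSet_Icc] at hae
      filter_upwards [hae] with θ hθ hI
      rw [uIoc_of_le Real.two_pi_pos.le] at hI
      show G.apply θ x (U θ) = G.apply θ x (U' θ)
      rw [hθ ⟨hI.1.le, hI.2⟩]
    exact ⟨U', hU', hU1', by rw [h1, hav U' hU' hU1', toCoord_ofCoord hx.1]⟩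
  · rintro ⟨U, hU, hU1, h⟩
    refine ⟨U, hU.aestronglyMeasurable, Eventually.of_forall hU1, ?_⟩
    rw [hav U hU hU1, ← h, ofCoord_toCoord hx.1]

/-- In the chart, a trajectory of the oscillating system solves the integral equation. -/
theorem exists_coord_of_isTrajectory {ε : ℝ} {u : ℝ → EuclideanSpace ℝ (Fin m)}
    (hu1 : ∀ t, ‖u t‖ ≤ 1) {x : ℝ → M} {a b : ℝ} (hab : a ≤ b)
    (hx : IsTrajectory G ε u x a b) (hdom : ∀ t ∈ Icc a b, x t ∈ D.dom) :
    ∃ ξ : ℝ → EuclideanSpace ℝ (Fin n), LipschitzWith D.B.toNNReal ξ ∧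
      (∀ t ∈ Icc a b, ξ t = extChartAt (𝓡 n) p (x t)) ∧
      ∀ s ∈ Icc a b, ∀ t ∈ Icc a b, ξ t - ξ s = ∫ r in s..t, D.F (r / ε) (ξ r) (u r) := by
  have hbd : ∀ t, ‖D.F (t / ε) (extChartAt (𝓡 n) p (x t)) (u t)‖ ≤ D.B := fun t ↦
    norm_apply_le_of_le (D.isField.bound _ _) (hu1 t)
  have h1 := (intervalIntegrable_and_sub_eq_integral (K := D.B)
    (g := fun t ↦ D.F (t / ε) (extChartAt (𝓡 n) p (x t)) (u t)) hab
    (absolutelyContinuousOnInterval_comp D.lip hx.1 (by rwa [uIcc_of_le hab])) (by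
      filter_upwards [hx.2] with t ht hI
      have hxd := hdom t ⟨hI.1.le, hI.2.le⟩
      have := hasDerivAt_chart p hxd.1 (ht hI)
      rwa [← D.F_eq _ hxd.1 hxd.2] at this) (Eventually.of_forall fun t _ ↦ hbd t)).2
  have hlip : LipschitzOnWith D.B.toNNReal (fun t ↦ extChartAt (𝓡 n) p (x t)) (Icc a b) := by
    refine LipschitzOnWith.of_dist_le_mul fun t ht s hs ↦ ?_
    rw [dist_eq_norm, h1 s hs t ht, Real.dist_eq, Real.coe_toNNReal _ D.isField.bound_nonneg]
    exact norm_integral_le_mul_sub (Eventually.of_forall fun t _ ↦ hbd t) hs ht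
  obtain ⟨ξ, hξ, hξe⟩ := exists_lipschitzWith_eqOn_Icc hab hlip
  refine ⟨ξ, hξ, hξe, fun s hs t ht ↦ ?_⟩
  rw [hξe hs, hξe ht]
  refine (h1 s hs t ht).trans (intervalIntegral.integral_congr fun r hr ↦ ?_)
  rw [hξe (uIcc_subset_Icc hs ht hr)]

/-- In the chart, a trajectory of the average system has velocities in the sets of means. -/
theorem exists_coord_of_isAverageTrajectory {x : ℝ → M} {a b : ℝ} (hab : a ≤ b)
    (hx : IsAverageTrajectory G x a b) (hdom : ∀ t ∈ Icc a b, x t ∈ D.dom) :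
    ∃ ξ g : ℝ → EuclideanSpace ℝ (Fin n), LipschitzWith D.B.toNNReal ξ ∧
      (∀ t ∈ Icc a b, ξ t = extChartAt (𝓡 n) p (x t)) ∧ IntervalIntegrable g volume a b ∧
      (∀ s ∈ Icc a b, ∀ t ∈ Icc a b, ξ t - ξ s = ∫ r in s..t, g r) ∧
      ∀ᵐ s, s ∈ Ioo a b → g s ∈ periodMeans fun θ ↦ D.F θ (ξ s) := by
  let f : ℝ → EuclideanSpace ℝ (Fin n) := fun t ↦ extChartAt (𝓡 n) p (x t)
  have hd : ∀ᵐ t, t ∈ Ioo a b → HasDerivAt f (deriv f t) t ∧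
      deriv f t ∈ periodMeans fun θ ↦ D.F θ (f t) := by
    filter_upwards [hx.2] with t ht hI
    have hxd := hdom t ⟨hI.1.le, hI.2.le⟩
    obtain ⟨v, hv, hxv⟩ := ht hI
    have h1 := hasDerivAt_chart p hxd.1 hxv
    have h2 : deriv f t = toCoord p (x t) v := h1.deriv
    rw [h2]
    exact ⟨h1, (D.mem_velocitySet_iff hxd v).1 hv⟩
  have hbd : ∀ᵐ t, t ∈ Ioo a b → ‖deriv f t‖ ≤ D.B := hd.mono fun t ht hI ↦
    norm_le_of_mem_periodMeans (fun θ ↦ D.isField.bound θ _) (ht hI).2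
  obtain ⟨hg, h1⟩ := intervalIntegrable_and_sub_eq_integral hab
    (absolutelyContinuousOnInterval_comp D.lip hx.1 (by rwa [uIcc_of_le hab]))
    (hd.mono fun t ht hI ↦ (ht hI).1) hbd
  have hlip : LipschitzOnWith D.B.toNNReal f (Icc a b) := by
    refine LipschitzOnWith.of_dist_le_mul fun t ht s hs ↦ ?_
    rw [dist_eq_norm, h1 s hs t ht, Real.dist_eq, Real.coe_toNNReal _ D.isField.bound_nonneg]
    exact norm_integral_le_mul_sub hbd hs ht
  obtain ⟨ξ, hξ, hξe⟩ := exists_lipschitzWith_eqOn_Icc hab hlip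
  refine ⟨ξ, deriv f, hξ, hξe, hg, fun s hs t ht ↦ ?_, ?_⟩
  · rw [hξe hs, hξe ht]
    exact h1 s hs t ht
  · filter_upwards [hd] with t ht hI
    rw [hξe ⟨hI.1.le, hI.2.le⟩]
    exact (ht hI).2

/-- A solution of the integral equation in the chart yields a trajectory in the manifold. -/
theorem isTrajectory_of_coord {ε : ℝ} {u : ℝ → EuclideanSpace ℝ (Fin m)} (hu : Measurable u)
    (hu1 : ∀ t, ‖u t‖ ≤ 1) {a b : ℝ} (hab : a ≤ b) {ξ : ℝ → EuclideanSpace ℝ (Fin n)}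
    (hξ : Continuous ξ)
    (hξe : ∀ t ∈ Icc a b, ξ t = ξ a + ∫ s in a..t, D.F (s / ε) (ξ s) (u s))
    (hball : ∀ t ∈ Icc a b, ξ t ∈ Metric.ball (extChartAt (𝓡 n) p p) D.r) :
    (∃ K, LipschitzOnWith K (fun t ↦ (extChartAt (𝓡 n) p).symm (ξ t)) (Icc a b)) ∧
      ∀ᵐ t, t ∈ Ioo a b → HasMFDerivAt 𝓘(ℝ, ℝ) (𝓡 n)
        (fun t ↦ (extChartAt (𝓡 n) p).symm (ξ t)) t ((1 : ℝ →L[ℝ] ℝ).smulRight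
          (G.apply (t / ε) ((extChartAt (𝓡 n) p).symm (ξ t)) (u t))) := by
  have hint := D.isField.intervalIntegrable ε hξ hu hu1
  constructor
  · have hlip : LipschitzOnWith D.B.toNNReal ξ (Icc a b) := by
      refine LipschitzOnWith.of_dist_le_mul fun t ht s hs ↦ ?_
      rw [dist_eq_norm, hξe t ht, hξe s hs, add_sub_add_left_eq_sub,
        intervalIntegral.integral_interval_sub_left (hint _ _) (hint _ _), Real.dist_eq,
        Real.coe_toNNReal _ D.isField.bound_nonneg]
      exact norm_integral_le_mul_sub (Eventually.of_forall fun r _ ↦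
        norm_apply_le_of_le (D.isField.bound _ _) (hu1 r)) hs ht
    exact ⟨_, D.lip_symm.comp hlip hball⟩
  · filter_upwards [(hint a b).ae_hasDerivAt_integral] with t ht hI
    have htI : t ∈ Icc a b := ⟨hI.1.le, hI.2.le⟩
    have h1 := (ht (by rwa [uIcc_of_le hab]) a left_mem_uIcc).const_add (ξ a)
    have h2 : HasDerivAt ξ (D.F (t / ε) (ξ t) (u t)) t := by
      refine h1.congr_of_eventuallyEq ?_
      filter_upwards [Icc_mem_nhds hI.1 hI.2] with s hs using hξe s hs
    have h3 := hasMFDerivAt_chart_symm p (D.ball_subset (hball t htI)) h2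
    have hd := D.symm_mem_dom (hball t htI)
    have h4 := D.F_eq _ hd.1 hd.2 (t / ε) (u t)
    rw [(extChartAt (𝓡 n) p).right_inv (D.ball_subset (hball t htI))] at h4
    rwa [h4, ofCoord_toCoord hd.1] at h3

end LocalModel

/-! ### Propagation along an interval -/

/-- A property of the right endpoint of `[0, b]` propagates to the whole of `[0, T]` as soon as it
propagates across all short intervals near each time `τ`. -/
theorem Icc_induction {T : ℝ} (hT : 0 ≤ T) (Q : ℝ → Prop) (h0 : Q 0)
    (hstep : ∀ τ ∈ Icc 0 T, ∃ δ > 0, ∀ a b, 0 ≤ a → a ≤ b → b ≤ T → |a - τ| < δ → |b - τ| < δ →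
      Q a → Q b) : Q T := by
  choose! δ hδ hQ using hstep
  let c : Icc (0 : ℝ) T → Set (Icc (0 : ℝ) T) := fun τ ↦ Metric.ball τ (δ τ)
  obtain ⟨t, ht0, htm, ⟨N, hN⟩, htc⟩ := exists_monotone_Icc_subset_open_cover_Icc hT (c := c)
    (fun _ ↦ Metric.isOpen_ball) fun τ _ ↦ mem_iUnion.2 ⟨τ, Metric.mem_ball_self (hδ τ τ.2)⟩
  have hall : ∀ k, Q (t k) := by
    intro k
    induction k with
    | zero => rwa [ht0]
    | succ k ih =>
      obtain ⟨τ, hτ⟩ := htc k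
      have hle : t k ≤ t (k + 1) := htm (Nat.le_succ k)
      exact hQ τ τ.2 (t k) (t (k + 1)) (t k).2.1 hle (t (k + 1)).2.2 (hτ ⟨le_rfl, hle⟩)
        (hτ ⟨hle, le_rfl⟩) ih
  have := hall N
  rwa [hN N le_rfl] at this

theorem exists_lipschitzOnWith_Icc_union {X : Type*} [PseudoMetricSpace X] {f : ℝ → X} {a b c : ℝ}
    {K₁ K₂ : NNReal} (hab : a ≤ b) (hbc : b ≤ c) (h₁ : LipschitzOnWith K₁ f (Icc a b))
    (h₂ : LipschitzOnWith K₂ f (Icc b c)) : LipschitzOnWith (max K₁ K₂) f (Icc a c) := by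
  replace h₁ := h₁.weaken (le_max_left K₁ K₂)
  replace h₂ := h₂.weaken (le_max_right K₁ K₂)
  have key : ∀ s ∈ Icc a c, ∀ t ∈ Icc a c, s ≤ t →
      dist (f s) (f t) ≤ (max K₁ K₂ : NNReal) * dist s t := by
    intro s hs t ht hst
    rcases le_total t b with htb | htb
    · exact h₁.dist_le_mul s ⟨hs.1, hst.trans htb⟩ t ⟨ht.1, htb⟩
    rcases le_total b s with hsb | hsb
    · exact h₂.dist_le_mul s ⟨hsb, hs.2⟩ t ⟨htb, ht.2⟩
    · refine (dist_triangle _ (f b) _).trans ((add_le_add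
        (h₁.dist_le_mul s ⟨hs.1, hsb⟩ b ⟨hab, le_rfl⟩)
        (h₂.dist_le_mul b ⟨le_rfl, hbc⟩ t ⟨htb, ht.2⟩)).trans_eq ?_)
      rw [← mul_add, Real.dist_eq, Real.dist_eq, Real.dist_eq, abs_of_nonpos (by linarith),
        abs_of_nonpos (by linarith), abs_of_nonpos (by linarith)]
      ring
  refine LipschitzOnWith.of_dist_le_mul fun s hs t ht ↦ ?_
  rcases le_total s t with h | h
  · exact key s hs t ht h
  · rw [dist_comm (f s), dist_comm s]
    exact key t ht s hs h

/-- At times near `τ`, a continuous curve stays in a given neighbourhood of its value at `τ`. -/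
theorem exists_forall_mem_of_continuousOn {X : Type*} [TopologicalSpace X] {x : ℝ → X} {T τ : ℝ}
    (hx : ContinuousOn x (Icc 0 T)) (hτ : τ ∈ Icc 0 T) {s : Set X} (hs : s ∈ 𝓝 (x τ)) :
    ∃ δ > 0, ∀ t ∈ Icc 0 T, |t - τ| < δ → x t ∈ s := by
  obtain ⟨δ, hδ, h⟩ := Metric.mem_nhdsWithin_iff.1 (hx τ hτ hs)
  exact ⟨δ, hδ, fun t ht htδ ↦ h ⟨htδ, ht⟩⟩

theorem abs_sub_lt_of_mem_Icc {a b t τ δ : ℝ} (ha : |a - τ| < δ) (hb : |b - τ| < δ)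
    (ht : t ∈ Icc a b) : |t - τ| < δ := by
  rw [abs_lt] at *
  exact ⟨by linarith [ht.1], by linarith [ht.2]⟩

/-- Intervals of length less than `2δ` with `δ = 1 / (4 (L + 1))` are short for the contraction
argument. -/
theorem mul_sub_le_half {L a b τ : ℝ} (hL : 0 ≤ L) (ha : |a - τ| < 1 / (4 * (L + 1)))
    (hb : |b - τ| < 1 / (4 * (L + 1))) : L * (b - a) ≤ 1 / 2 := by
  have h1 : b - a ≤ 2 * (1 / (4 * (L + 1))) := by
    rw [abs_lt] at ha hb
    linarith
  calc L * (b - a) ≤ L * (2 * (1 / (4 * (L + 1)))) := mul_le_mul_of_nonneg_left h1 hL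
    _ ≤ (L + 1) * (2 * (1 / (4 * (L + 1)))) := by gcongr; linarith
    _ = 1 / 2 := by field_simp; norm_num

section

variable {m n : ℕ} {M : Type*} [MetricSpace M] [ChartedSpace (EuclideanSpace ℝ (Fin n)) M]
  [IsManifold (𝓡 n) ∞ M] {G : OscillatingFields m n M}

/-! ### Uniqueness of trajectories -/

theorem LocalModel.eq_of_isTrajectory {p : M} (D : LocalModel G p) {ε : ℝ}
    {u : ℝ → EuclideanSpace ℝ (Fin m)} (hu : Measurable u) (hu1 : ∀ t, ‖u t‖ ≤ 1) {x y : ℝ → M}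
    {a b : ℝ} (hab : a ≤ b) (hL : D.L * (b - a) ≤ 1 / 2) (hx : IsTrajectory G ε u x a b)
    (hy : IsTrajectory G ε u y a b) (hxD : ∀ t ∈ Icc a b, x t ∈ D.dom)
    (hyD : ∀ t ∈ Icc a b, y t ∈ D.dom) (h : x a = y a) : EqOn x y (Icc a b) := by
  obtain ⟨ξ, hξ, hξx, hξe⟩ := D.exists_coord_of_isTrajectory hu1 hab hx hxD
  obtain ⟨η, hη, hηy, hηe⟩ := D.exists_coord_of_isTrajectory hu1 hab hy hyD
  have haI : a ∈ Icc a b := ⟨le_rfl, hab⟩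
  intro t ht
  have h1 := D.isField.norm_solution_sub_le D.L_nonneg ε hL hu hu1 hξ.continuous hη.continuous
    (δ := 0) (fun t ht ↦ by rw [← hξe a haI t ht]; abel)
    (fun t ht ↦ by rw [hηe a haI t ht, sub_self, norm_zero]) t ht
  rw [hξx a haI, hηy a haI, h, sub_self, norm_zero, add_zero, mul_zero, hξx t ht, hηy t ht,
    norm_le_zero_iff, sub_eq_zero] at h1
  exact (extChartAt (𝓡 n) p).injOn (hxD t ht).1 (hyD t ht).1 h1

/-- Trajectories with the same control and the same initial point agree. -/
theorem eqOn_of_isTrajectory (hG : ∀ p, Nonempty (LocalModel G p)) {ε T : ℝ} (hT : 0 ≤ T)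
    {u : ℝ → EuclideanSpace ℝ (Fin m)} (hu : Measurable u) (hu1 : ∀ t, ‖u t‖ ≤ 1) {x y : ℝ → M}
    (hx : IsTrajectory G ε u x 0 T) (hy : IsTrajectory G ε u y 0 T) (h : x 0 = y 0) :
    EqOn x y (Icc 0 T) := by
  have hxc := hx.continuousOn hT
  have hyc := hy.continuousOn hT
  refine Icc_induction hT (fun b ↦ EqOn x y (Icc 0 b)) (fun t ht ↦ ?_) fun τ hτ ↦ ?_
  · rw [Icc_self, mem_singleton_iff] at ht
    rw [ht, h]
  by_cases hne : x τ = y τ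
  · obtain ⟨D⟩ := hG (x τ)
    obtain ⟨δ₁, hδ₁, h₁⟩ := exists_forall_mem_of_continuousOn hxc hτ
      (D.isOpen_dom.mem_nhds D.mem_dom)
    obtain ⟨δ₂, hδ₂, h₂⟩ := exists_forall_mem_of_continuousOn hyc hτ
      (by rw [← hne]; exact D.isOpen_dom.mem_nhds D.mem_dom)
    have hL := D.L_nonneg
    refine ⟨min (min δ₁ δ₂) (1 / (4 * (D.L + 1))), by positivity,
      fun a b ha hab hb haτ hbτ hQ t ht ↦ ?_⟩
    rcases le_total t a with hta | hta
    · exact hQ ⟨ht.1, hta⟩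
    · simp only [lt_min_iff] at haτ hbτ
      refine D.eq_of_isTrajectory hu hu1 hab (mul_sub_le_half hL haτ.2 hbτ.2)
        (hx.mono ha hab hb) (hy.mono ha hab hb) (fun s hs ↦ ?_) (fun s hs ↦ ?_)
        (hQ ⟨ha, le_rfl⟩) ⟨hta, ht.2⟩
      · exact h₁ s ⟨ha.trans hs.1, hs.2.trans hb⟩ (abs_sub_lt_of_mem_Icc haτ.1.1 hbτ.1.1 hs)
      · exact h₂ s ⟨ha.trans hs.1, hs.2.trans hb⟩ (abs_sub_lt_of_mem_Icc haτ.1.2 hbτ.1.2 hs)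
  · -- the curves differ near `τ`, so that they cannot agree at a nearby time `a`
    obtain ⟨δ, hδ, h₁⟩ := exists_forall_mem_of_continuousOn (x := fun t ↦ (x t, y t))
      (hxc.prodMk hyc) hτ (s := (diagonal M)ᶜ) (isClosed_diagonal.isOpen_compl.mem_nhds hne)
    exact ⟨δ, hδ, fun a b ha hab hb haτ _ hQ ↦
      (h₁ a ⟨ha, hab.trans hb⟩ haτ (hQ ⟨ha, le_rfl⟩)).elim⟩

/-! ### Approximation of average trajectories in the manifold -/

/-- Inside a chart and on a short interval, an average trajectory is followed up to an error of
order `ε` by oscillating trajectories, whose initial points are within `O(ε)` of its own. -/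
theorem LocalModel.exists_approx {p : M} (D : LocalModel G p) {x₀ : ℝ → M} {a b : ℝ} (hab : a ≤ b)
    (hL : D.L * (b - a) ≤ 1 / 2) (hx₀ : IsAverageTrajectory G x₀ a b)
    (hin : ∀ t ∈ Icc a b, x₀ t ∈ D.dom ∧
      extChartAt (𝓡 n) p (x₀ t) ∈ Metric.ball (extChartAt (𝓡 n) p p) (D.r / 2))
    {ca : ℝ} (hca : 0 ≤ ca) :
    ∃ cb ε₁ : ℝ, 0 ≤ cb ∧ 0 < ε₁ ∧ ∀ ε, 0 < ε → ε < ε₁ →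
      ∃ u : ℝ → EuclideanSpace ℝ (Fin m), Measurable u ∧ (∀ t, ‖u t‖ ≤ 1) ∧
        ∀ ya, dist ya (x₀ a) ≤ ca * ε → ∃ x : ℝ → M, x a = ya ∧
          (∃ K, LipschitzOnWith K x (Icc a b)) ∧
          (∀ᵐ t, t ∈ Ioo a b → HasMFDerivAt 𝓘(ℝ, ℝ) (𝓡 n) x t
            ((1 : ℝ →L[ℝ] ℝ).smulRight (G.apply (t / ε) (x t) (u t)))) ∧
          ∀ t ∈ Icc a b, dist (x t) (x₀ t) ≤ cb * ε := by
  have haI : a ∈ Icc a b := ⟨le_rfl, hab⟩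
  obtain ⟨ξ₀, g, hξ₀, hξ₀x, hg, hξ₀g, hmem⟩ :=
    D.exists_coord_of_isAverageTrajectory hab hx₀ fun t ht ↦ (hin t ht).1
  obtain ⟨C, hC0, hC⟩ :=
    D.isField.exists_control_approx D.L_nonneg hab hξ₀ hg hξ₀g hmem
  obtain ⟨ρ, hρ0, hρ⟩ := Metric.isOpen_iff.1 D.isOpen_dom _ (hin a haI).1
  set c' : ℝ := 2 * (D.C * ca + C) with hc'
  have hc'0 : 0 ≤ c' := by positivity
  have hr := D.r_pos
  refine ⟨D.C * c', min (ρ / (ca + 1)) (D.r / 2 / (c' + 1)), by positivity, by positivity,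
    fun ε hε hε₁ ↦ ?_⟩
  obtain ⟨hε₂, hε₃⟩ := lt_min_iff.1 hε₁
  rw [lt_div_iff₀ (by positivity)] at hε₂ hε₃
  obtain ⟨u, hu, hu1, hue⟩ := hC ε hε
  refine ⟨u, hu, hu1, fun ya hya ↦ ?_⟩
  have hyD : ya ∈ D.dom := hρ (by rw [Metric.mem_ball]; nlinarith)
  obtain ⟨ξ, hξ, hξe⟩ := D.isField.exists_solution D.L_nonneg ε hab hL hu hu1
    (extChartAt (𝓡 n) p ya)
  have hξa : ξ a = extChartAt (𝓡 n) p ya := by simpa using hξe a haI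
  have hξe' : ∀ t ∈ Icc a b, ξ t = ξ a + ∫ s in a..t, D.F (s / ε) (ξ s) (u s) := by
    rwa [hξa]
  have hclose : ∀ t ∈ Icc a b, ‖ξ t - ξ₀ t‖ ≤ c' * ε := by
    intro t ht
    refine (D.isField.norm_solution_sub_le D.L_nonneg ε hL hu hu1 hξ hξ₀.continuous hξe'
      hue t ht).trans ?_
    have h1 : ‖ξ a - ξ₀ a‖ ≤ D.C * (ca * ε) := by
      rw [hξa, hξ₀x a haI, ← dist_eq_norm]
      exact (D.lip.dist_le_mul _ hyD _ (hin a haI).1).trans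
        (mul_le_mul_of_nonneg_left hya D.C.coe_nonneg)
    rw [hc']
    nlinarith
  have hball₀ : ∀ t ∈ Icc a b, ξ₀ t ∈ Metric.ball (extChartAt (𝓡 n) p p) (D.r / 2) :=
    fun t ht ↦ by rw [hξ₀x t ht]; exact (hin t ht).2
  have hball : ∀ t ∈ Icc a b, ξ t ∈ Metric.ball (extChartAt (𝓡 n) p p) D.r := by
    intro t ht
    have h1 := hball₀ t ht
    have h2 := hclose t ht
    rw [← dist_eq_norm] at h2
    rw [Metric.mem_ball] at h1 ⊢
    have := dist_triangle (ξ t) (ξ₀ t) (extChartAt (𝓡 n) p p)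
    nlinarith
  obtain ⟨hlip, hder⟩ := D.isTrajectory_of_coord hu hu1 hab hξ hξe' hball
  refine ⟨fun t ↦ (extChartAt (𝓡 n) p).symm (ξ t), ?_, hlip, hder, fun t ht ↦ ?_⟩
  · show (extChartAt (𝓡 n) p).symm (ξ a) = ya
    rw [hξa, (extChartAt (𝓡 n) p).left_inv hyD.1]
  · have h1 : x₀ t = (extChartAt (𝓡 n) p).symm (ξ₀ t) := by
      rw [hξ₀x t ht, (extChartAt (𝓡 n) p).left_inv (hin t ht).1.1]
    rw [h1, mul_assoc]
    refine (D.lip_symm.dist_le_mul _ (hball t ht) _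
      (Metric.ball_subset_ball (by linarith) (hball₀ t ht))).trans ?_
    rw [dist_eq_norm]
    exact mul_le_mul_of_nonneg_left (hclose t ht) D.C.coe_nonneg

/-- The average trajectory `x₀` is followed on `[0, b]`, up to an error of order `ε`, by oscillating
trajectories with the same initial point. -/
def IsApproximable (G : OscillatingFields m n M) (x₀ : ℝ → M) (b : ℝ) : Prop :=
  ∃ c ε₁ : ℝ, 0 ≤ c ∧ 0 < ε₁ ∧ ∀ ε, 0 < ε → ε < ε₁ →
    ∃ u : ℝ → EuclideanSpace ℝ (Fin m), Measurable u ∧ (∀ t, ‖u t‖ ≤ 1) ∧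
      ∃ x : ℝ → M, x 0 = x₀ 0 ∧ (∃ K, LipschitzOnWith K x (Icc 0 b)) ∧
        (∀ᵐ t, t ∈ Ioo 0 b → HasMFDerivAt 𝓘(ℝ, ℝ) (𝓡 n) x t
          ((1 : ℝ →L[ℝ] ℝ).smulRight (G.apply (t / ε) (x t) (u t)))) ∧
        ∀ t ∈ Icc 0 b, dist (x t) (x₀ t) ≤ c * ε

theorem hasMFDerivAt_apply_congr {x y : ℝ → M} {t θ : ℝ} {w : EuclideanSpace ℝ (Fin m)}
    (he : y =ᶠ[𝓝 t] x)
    (h : HasMFDerivAt 𝓘(ℝ, ℝ) (𝓡 n) x t ((1 : ℝ →L[ℝ] ℝ).smulRight (G.apply θ (x t) w))) :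
    HasMFDerivAt 𝓘(ℝ, ℝ) (𝓡 n) y t ((1 : ℝ →L[ℝ] ℝ).smulRight (G.apply θ (y t) w)) := by
  -- the tangent spaces at `x t` and `y t` are both the fixed vector space `ℝⁿ`
  let A : M → ℝ →L[ℝ] EuclideanSpace ℝ (Fin n) := fun z ↦
    (1 : ℝ →L[ℝ] ℝ).smulRight (G.apply θ z w : EuclideanSpace ℝ (Fin n))
  have hA : A (y t) = A (x t) := by rw [he.eq_of_nhds]
  have h' : HasMFDerivAt 𝓘(ℝ, ℝ) (𝓡 n) y t (A (x t)) := h.congr_of_eventuallyEq he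
  rw [← hA] at h'
  exact h'

theorem exists_hasMFDerivAt_velocitySet_congr {x y : ℝ → M} {t : ℝ} (he : y =ᶠ[𝓝 t] x)
    (h : ∃ v ∈ G.velocitySet (x t),
      HasMFDerivAt 𝓘(ℝ, ℝ) (𝓡 n) x t ((1 : ℝ →L[ℝ] ℝ).smulRight v)) :
    ∃ v ∈ G.velocitySet (y t),
      HasMFDerivAt 𝓘(ℝ, ℝ) (𝓡 n) y t ((1 : ℝ →L[ℝ] ℝ).smulRight v) := by
  obtain ⟨v, hv, h⟩ := h
  let E : M → Set (EuclideanSpace ℝ (Fin n)) := fun z ↦ G.velocitySet z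
  have hv' : v ∈ E (x t) := hv
  rw [← he.eq_of_nhds] at hv'
  exact ⟨v, hv', h.congr_of_eventuallyEq he⟩

/-- Approximating trajectories are prolonged by concatenation. -/
theorem IsApproximable.extend {p : M} (D : LocalModel G p) {x₀ : ℝ → M} {a b : ℝ} (ha : 0 ≤ a)
    (hab : a ≤ b) (hL : D.L * (b - a) ≤ 1 / 2) (hx₀ : IsAverageTrajectory G x₀ a b)
    (hin : ∀ t ∈ Icc a b, x₀ t ∈ D.dom ∧
      extChartAt (𝓡 n) p (x₀ t) ∈ Metric.ball (extChartAt (𝓡 n) p p) (D.r / 2))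
    (h : IsApproximable G x₀ a) : IsApproximable G x₀ b := by
  classical
  obtain ⟨ca, ε₁, hca, hε₁, hA⟩ := h
  obtain ⟨cb, ε₂, hcb, hε₂, hB⟩ := D.exists_approx hab hL hx₀ hin hca
  refine ⟨max ca cb, min ε₁ ε₂, le_max_of_le_left hca, lt_min hε₁ hε₂, fun ε hε hεlt ↦ ?_⟩
  obtain ⟨hlt₁, hlt₂⟩ := lt_min_iff.1 hεlt
  obtain ⟨u, hu, hu1, x, hx0, ⟨K, hK⟩, hxd, hxe⟩ := hA ε hε hlt₁
  obtain ⟨u', hu', hu1', hB'⟩ := hB ε hε hlt₂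
  obtain ⟨x', hx'a, ⟨K', hK'⟩, hxd', hxe'⟩ := hB' (x a) (hxe a ⟨ha, le_rfl⟩)
  let v : ℝ → EuclideanSpace ℝ (Fin m) := fun t ↦ if t ≤ a then u t else u' t
  let y : ℝ → M := fun t ↦ if t ≤ a then x t else x' t
  have hy₁ : ∀ t, t ≤ a → y t = x t := fun t ht ↦ by simp only [y, if_pos ht]
  have hy₂ : ∀ t, a ≤ t → y t = x' t := fun t ht ↦ by
    rcases ht.eq_or_lt with rfl | ht
    · rw [hy₁ _ le_rfl, hx'a]
    · simp only [y, if_neg (not_le.2 ht)]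
  refine ⟨v, Measurable.ite measurableSet_Iic hu hu', fun t ↦ ?_, y, ?_,
    ⟨max K K', exists_lipschitzOnWith_Icc_union ha hab ?_ ?_⟩, ?_, fun t ht ↦ ?_⟩
  · simp only [v]
    split_ifs
    exacts [hu1 t, hu1' t]
  · rw [hy₁ 0 ha, hx0]
  · intro s hs t ht
    rw [hy₁ s hs.2, hy₁ t ht.2]
    exact hK hs ht
  · intro s hs t ht
    rw [hy₂ s hs.1, hy₂ t ht.1]
    exact hK' hs ht
  · have hne : ∀ᵐ t : ℝ, t ≠ a := by simp [ae_iff, measure_singleton]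
    filter_upwards [hxd, hxd', hne] with t h₁ h₂ hta hI
    rcases lt_or_gt_of_ne hta with hlt | hgt
    · have he : y =ᶠ[𝓝 t] x := by
        filter_upwards [Iio_mem_nhds hlt] with s hs using hy₁ s (le_of_lt hs)
      have hv : v t = u t := by simp only [v, if_pos hlt.le]
      rw [hv]
      exact hasMFDerivAt_apply_congr he (h₁ ⟨hI.1, hlt⟩)
    · have he : y =ᶠ[𝓝 t] x' := by
        filter_upwards [Ioi_mem_nhds hgt] with s hs using hy₂ s (le_of_lt hs)
      have hv : v t = u' t := by simp only [v, if_neg (not_le.2 hgt)]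
      rw [hv]
      exact hasMFDerivAt_apply_congr he (h₂ ⟨hgt, hI.2⟩)
  · rcases le_total t a with hta | hta
    · rw [hy₁ t hta]
      exact (hxe t ⟨ht.1, hta⟩).trans (mul_le_mul_of_nonneg_right (le_max_left _ _) hε.le)
    · rw [hy₂ t hta]
      exact (hxe' t ⟨hta, ht.2⟩).trans (mul_le_mul_of_nonneg_right (le_max_right _ _) hε.le)

theorem isApproximable_of_isAverageTrajectory (hG : ∀ p, Nonempty (LocalModel G p)) {T : ℝ}
    (hT : 0 ≤ T) {x₀ : ℝ → M} (hx₀ : IsAverageTrajectory G x₀ 0 T) : IsApproximable G x₀ T := by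
  refine Icc_induction hT (IsApproximable G x₀) ?_ fun τ hτ ↦ ?_
  · refine ⟨0, 1, le_rfl, one_pos, fun ε _ _ ↦ ⟨fun _ ↦ 0, measurable_const, by simp,
      fun _ ↦ x₀ 0, rfl, ⟨0, (LipschitzWith.const _).lipschitzOnWith⟩, ?_, fun t ht ↦ ?_⟩⟩
    · exact Eventually.of_forall fun t ht ↦ by simp at ht
    · rw [Icc_self, mem_singleton_iff] at ht
      simp [ht]
  · obtain ⟨D⟩ := hG (x₀ τ)
    let s : Set M := (extChartAt (𝓡 n) (x₀ τ)).source ∩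
      extChartAt (𝓡 n) (x₀ τ) ⁻¹' Metric.ball (extChartAt (𝓡 n) (x₀ τ) (x₀ τ)) (D.r / 2)
    have hr := D.r_pos
    have hs : s ∈ 𝓝 (x₀ τ) := (isOpen_extChartAt_preimage' _ Metric.isOpen_ball).mem_nhds
      ⟨mem_extChartAt_source _, Metric.mem_ball_self (by positivity)⟩
    obtain ⟨δ, hδ, h₁⟩ := exists_forall_mem_of_continuousOn (hx₀.continuousOn hT) hτ hs
    have hL := D.L_nonneg
    refine ⟨min δ (1 / (4 * (D.L + 1))), by positivity, fun a b ha hab hb haτ hbτ hQ ↦ ?_⟩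
    simp only [lt_min_iff] at haτ hbτ
    refine IsApproximable.extend D ha hab (mul_sub_le_half hL haτ.2 hbτ.2) (hx₀.mono ha hab hb)
      (fun t ht ↦ ?_) hQ
    have := h₁ t ⟨ha.trans ht.1, ht.2.trans hb⟩ (abs_sub_lt_of_mem_Icc haτ.1 hbτ.1 ht)
    exact ⟨⟨this.1, Metric.ball_subset_ball (by linarith) this.2⟩, this.2⟩

theorem exists_controls_approximating (hG : ∀ p, Nonempty (LocalModel G p)) {T : ℝ} (hT : 0 < T)
    {x₀ : ℝ → M} (hx₀ : G.IsAverageSolution T x₀) :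
    ∃ (u : ℝ → ℝ → EuclideanSpace ℝ (Fin m)) (c ε₀ : ℝ), 0 < c ∧ 0 < ε₀ ∧
      (∀ ε, 0 < ε → Measurable (u ε) ∧ ∀ t, ‖u ε t‖ ≤ 1) ∧
      ∀ ε, 0 < ε → ε < ε₀ →
        ∃ x : ℝ → M, G.IsSolution ε T (u ε) x ∧ x 0 = x₀ 0 ∧
          (∀ y : ℝ → M, G.IsSolution ε T (u ε) y → y 0 = x₀ 0 → EqOn y x (Icc 0 T)) ∧
          ∀ t ∈ Icc 0 T, dist (x t) (x₀ t) < c * ε := by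
  classical
  obtain ⟨c, ε₁, hc, hε₁, h⟩ := isApproximable_of_isAverageTrajectory hG hT.le
    ((isAverageSolution_iff G T x₀).1 hx₀)
  choose! u hu hu1 hx using h
  let v : ℝ → ℝ → EuclideanSpace ℝ (Fin m) := fun ε ↦ if ε < ε₁ then u ε else fun _ ↦ 0
  refine ⟨v, c + 1, ε₁, by positivity, hε₁, fun ε hε ↦ ?_, fun ε hε hlt ↦ ?_⟩
  · by_cases hlt : ε < ε₁
    · simp only [v, if_pos hlt]
      exact ⟨hu ε hε hlt, hu1 ε hε hlt⟩
    · simp only [v, if_neg hlt]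
      exact ⟨measurable_const, by simp⟩
  · have hv : v ε = u ε := by simp only [v, if_pos hlt]
    rw [hv]
    obtain ⟨x, hx0, ⟨K, hK⟩, hxd, hxe⟩ := hx ε hε hlt
    have hxt : IsTrajectory G ε (u ε) x 0 T := by
      refine ⟨LipschitzOnWith.absolutelyContinuousOnInterval (K := K) ?_, hxd⟩
      rwa [uIcc_of_le hT.le]
    refine ⟨x, (isSolution_iff G ε T _ x).2 hxt, hx0, fun y hy hy0 ↦ ?_, fun t ht ↦ ?_⟩
    · exact eqOn_of_isTrajectory hG hT.le (hu ε hε hlt) (hu1 ε hε hlt)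
        ((isSolution_iff G ε T _ y).1 hy) hxt (hy0.trans hx0.symm)
    · exact (hxe t ht).trans_lt (by linarith)

end

/-! ### Compactness of the set of trajectories -/

/-- A form of the Arzelà–Ascoli theorem. -/
theorem isCompact_setOf_lipschitzWith {X Y : Type*} [PseudoMetricSpace X] [MetricSpace Y]
    (Λ : NNReal) {K : Set Y} (hK : IsCompact K) :
    IsCompact {f : C(X, Y) | LipschitzWith Λ f ∧ ∀ t, f t ∈ K} := by
  refine ArzelaAscoli.isCompact_of_equicontinuous _ ?_ ?_
  · have himage : ContinuousMap.toFun '' {f : C(X, Y) | LipschitzWith Λ f ∧ ∀ t, f t ∈ K} =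
        univ.pi (fun _ ↦ K) ∩ {f : X → Y | ∀ s t, dist (f s) (f t) ≤ Λ * dist s t} := by
      ext f
      constructor
      · rintro ⟨f, ⟨hf, hfK⟩, rfl⟩
        exact ⟨fun t _ ↦ hfK t, hf.dist_le_mul⟩
      · rintro ⟨hfK, hf⟩
        have hf' := LipschitzWith.of_dist_le_mul hf
        exact ⟨⟨f, hf'.continuous⟩, ⟨hf', fun t ↦ hfK t (mem_univ t)⟩, rfl⟩
    rw [himage]
    refine (isCompact_univ_pi fun _ ↦ hK).inter_right ?_
    simp only [Set.ofPred_forall]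
    exact isClosed_iInter fun s ↦ isClosed_iInter fun t ↦
      isClosed_le ((continuous_apply s).dist (continuous_apply t)) continuous_const
  · refine (UniformEquicontinuous.equicontinuous ?_)
    refine Metric.uniformEquicontinuous_of_continuity_modulus (fun r ↦ Λ * r) ?_ _
      fun s t f ↦ f.2.1.dist_le_mul s t
    have : Tendsto (fun r : ℝ ↦ (Λ : ℝ) * r) (𝓝 0) (𝓝 (Λ * 0)) :=
      (continuous_const.mul continuous_id).tendsto 0
    rwa [mul_zero] at this

section

variable {m n : ℕ} {M : Type*} [MetricSpace M] [ChartedSpace (EuclideanSpace ℝ (Fin n)) M]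
  [IsManifold (𝓡 n) ∞ M] {G : OscillatingFields m n M}

theorem LocalModel.lipschitzOnWith_of_isTrajectory {p : M} (D : LocalModel G p) {ε : ℝ}
    {u : ℝ → EuclideanSpace ℝ (Fin m)} (hu1 : ∀ t, ‖u t‖ ≤ 1) {x : ℝ → M} {a b : ℝ} (hab : a ≤ b)
    (hx : IsTrajectory G ε u x a b) (hdom : ∀ t ∈ Icc a b, x t ∈ D.dom) :
    LipschitzOnWith (D.C * D.B.toNNReal) x (Icc a b) := by
  obtain ⟨ξ, hξ, hξx, -⟩ := D.exists_coord_of_isTrajectory hu1 hab hx hdom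
  have h1 : LipschitzOnWith (D.C * D.B.toNNReal) ((extChartAt (𝓡 n) p).symm ∘ ξ) (Icc a b) :=
    D.lip_symm.comp hξ.lipschitzOnWith fun t ht ↦ by
      rw [hξx t ht]
      exact (hdom t ht).2
  have h2 : EqOn x ((extChartAt (𝓡 n) p).symm ∘ ξ) (Icc a b) := fun t ht ↦ by
    rw [Function.comp_apply, hξx t ht, (extChartAt (𝓡 n) p).left_inv (hdom t ht).1]
  intro s hs t ht
  rw [h2 hs, h2 ht]
  exact h1 hs ht

/-- Trajectories in a compact set have a common Lipschitz constant, since the set is covered by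
finitely many charts. -/
theorem exists_lipschitzOnWith_of_isCompact (hG : ∀ p, Nonempty (LocalModel G p)) {K : Set M}
    (hK : IsCompact K) {T : ℝ} (hT : 0 ≤ T) :
    ∃ Λ : NNReal, ∀ (ε : ℝ) (u : ℝ → EuclideanSpace ℝ (Fin m)) (x : ℝ → M), (∀ t, ‖u t‖ ≤ 1) →
      IsTrajectory G ε u x 0 T → (∀ t ∈ Icc 0 T, x t ∈ K) → LipschitzOnWith Λ x (Icc 0 T) := by
  have D := fun p ↦ (hG p).some
  obtain ⟨N, -, hN⟩ := hK.elim_nhds_subcover (fun p ↦ (D p).dom) fun p _ ↦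
    (D p).isOpen_dom.mem_nhds (D p).mem_dom
  let Λ := N.sup fun p ↦ (D p).C * (D p).B.toNNReal
  refine ⟨Λ, fun ε u x hu1 hx hxK ↦ ?_⟩
  refine Icc_induction hT (fun b ↦ LipschitzOnWith Λ x (Icc 0 b)) ?_ fun τ hτ ↦ ?_
  · simp [LipschitzOnWith]
  obtain ⟨p, hp, hpx⟩ := mem_iUnion₂.1 (hN (hxK τ hτ))
  obtain ⟨δ, hδ, h⟩ := exists_forall_mem_of_continuousOn (hx.continuousOn hT) hτ
    ((D p).isOpen_dom.mem_nhds hpx)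
  refine ⟨δ, hδ, fun a b ha hab hb haτ hbτ hQ ↦ ?_⟩
  have h1 := (D p).lipschitzOnWith_of_isTrajectory hu1 hab (hx.mono ha hab hb) fun t ht ↦
    h t ⟨ha.trans ht.1, ht.2.trans hb⟩ (abs_sub_lt_of_mem_Icc haτ hbτ ht)
  have h2 : (D p).C * (D p).B.toNNReal ≤ Λ :=
    Finset.le_sup (f := fun p ↦ (D p).C * (D p).B.toNNReal) hp
  have h3 := exists_lipschitzOnWith_Icc_union ha hab hQ h1
  rwa [max_eq_left h2] at h3

/-! ### Limits of oscillating trajectories -/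

/-- Inside a chart, a uniform limit of oscillating trajectories has its velocities in the velocity
sets. It is Lipschitz, hence differentiable at almost all times by Rademacher's theorem. -/
theorem LocalModel.velocity_mem_of_approx {p : M} (D : LocalModel G p) {z : ℝ → M} {a b : ℝ}
    (hab : a ≤ b) {Λ : NNReal} (hz : LipschitzOnWith Λ z (Icc a b))
    (hdom : ∀ t ∈ Icc a b, z t ∈ D.dom)
    (happrox : ∀ δ > 0, ∃ ε, 0 < ε ∧ ε < δ ∧ ∃ u : ℝ → EuclideanSpace ℝ (Fin m), Measurable u ∧
      (∀ t, ‖u t‖ ≤ 1) ∧ ∃ x, IsTrajectory G ε u x a b ∧ ∀ t ∈ Icc a b, dist (x t) (z t) < δ) :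
    ∀ᵐ t, t ∈ Ioo a b → ∃ v ∈ G.velocitySet (z t),
      HasMFDerivAt 𝓘(ℝ, ℝ) (𝓡 n) z t ((1 : ℝ →L[ℝ] ℝ).smulRight v) := by
  obtain ⟨ζ, hζ, hζz⟩ := exists_lipschitzWith_eqOn_Icc hab (D.lip.comp hz hdom)
  -- curves close to `z` stay in the chart
  obtain ⟨ρ, hρ, hρD⟩ := (isCompact_Icc.image_of_continuousOn
    hz.continuousOn).exists_thickening_subset_open D.isOpen_dom (image_subset_iff.2 hdom)
  have happrox' : ∀ δ > 0, ∃ ε, 0 < ε ∧ ε < δ ∧ ∃ u : ℝ → EuclideanSpace ℝ (Fin m),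
      Measurable u ∧ (∀ t, ‖u t‖ ≤ 1) ∧ ∃ ξ : ℝ → EuclideanSpace ℝ (Fin n), Continuous ξ ∧
        (∀ s ∈ Icc a b, ‖ξ s - ζ s‖ ≤ δ) ∧
        ∀ s ∈ Icc a b, ∀ t ∈ Icc a b, ξ t - ξ s = ∫ r in s..t, D.F (r / ε) (ξ r) (u r) := by
    intro δ hδ
    obtain ⟨ε, hε, hεδ, u, hu, hu1, x, hx, hxz⟩ :=
      happrox (min δ (min ρ (δ / (D.C + 1)))) (by positivity)
    simp only [lt_min_iff] at hεδ hxz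
    have hxD : ∀ t ∈ Icc a b, x t ∈ D.dom := fun t ht ↦
      hρD (Metric.mem_thickening_iff.2 ⟨z t, mem_image_of_mem z ht, (hxz t ht).2.1⟩)
    obtain ⟨ξ, hξ, hξx, hξe⟩ := D.exists_coord_of_isTrajectory hu1 hab hx hxD
    refine ⟨ε, hε, hεδ.1, u, hu, hu1, ξ, hξ.continuous, fun s hs ↦ ?_, hξe⟩
    rw [hξx s hs, hζz hs, ← dist_eq_norm]
    refine (D.lip.dist_le_mul _ (hxD s hs) _ (hdom s hs)).trans ?_
    calc D.C * dist (x s) (z s) ≤ (D.C + 1) * (δ / (D.C + 1)) := by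
          gcongr
          · simp
          · exact (hxz s hs).2.2.le
      _ = δ := by field_simp
  filter_upwards [hζ.ae_differentiableAt] with t hd ht
  have htI : t ∈ Icc a b := ⟨ht.1.le, ht.2.le⟩
  have hw := D.isField.deriv_mem_periodMeans_of_approx D.L_nonneg hζ happrox' ht hd.hasDerivAt
  have hzt : ζ t = extChartAt (𝓡 n) p (z t) := hζz htI
  have hball : ζ t ∈ Metric.ball (extChartAt (𝓡 n) p p) D.r := by
    rw [hzt]
    exact (hdom t htI).2
  have htgt := D.ball_subset hball
  have hsD := D.symm_mem_dom hball
  refine exists_hasMFDerivAt_velocitySet_congr (x := fun s ↦ (extChartAt (𝓡 n) p).symm (ζ s)) ?_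
    ⟨ofCoord p ((extChartAt (𝓡 n) p).symm (ζ t)) (deriv ζ t), ?_,
      hasMFDerivAt_chart_symm p htgt hd.hasDerivAt⟩
  · filter_upwards [Icc_mem_nhds ht.1 ht.2] with s hs
    rw [hζz hs]
    exact ((extChartAt (𝓡 n) p).left_inv (hdom s hs).1).symm
  · rw [D.mem_velocitySet_iff hsD, toCoord_ofCoord hsD.1, (extChartAt (𝓡 n) p).right_inv htgt]
    exact hw

theorem isAverageTrajectory_of_approx (hG : ∀ p, Nonempty (LocalModel G p)) {T : ℝ} (hT : 0 ≤ T)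
    {z : ℝ → M} {Λ : NNReal} (hz : LipschitzOnWith Λ z (Icc 0 T))
    (happrox : ∀ δ > 0, ∃ ε, 0 < ε ∧ ε < δ ∧ ∃ u : ℝ → EuclideanSpace ℝ (Fin m), Measurable u ∧
      (∀ t, ‖u t‖ ≤ 1) ∧ ∃ x, IsTrajectory G ε u x 0 T ∧ ∀ t ∈ Icc 0 T, dist (x t) (z t) < δ) :
    IsAverageTrajectory G z 0 T := by
  refine ⟨LipschitzOnWith.absolutelyContinuousOnInterval (K := Λ) (by rwa [uIcc_of_le hT]), ?_⟩
  refine Icc_induction hT (fun b ↦ ∀ᵐ t, t ∈ Ioo 0 b → ∃ v ∈ G.velocitySet (z t),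
    HasMFDerivAt 𝓘(ℝ, ℝ) (𝓡 n) z t ((1 : ℝ →L[ℝ] ℝ).smulRight v)) (by simp) fun τ hτ ↦ ?_
  obtain ⟨D⟩ := hG (z τ)
  obtain ⟨δ, hδ, h⟩ := exists_forall_mem_of_continuousOn hz.continuousOn hτ
    (D.isOpen_dom.mem_nhds D.mem_dom)
  refine ⟨δ, hδ, fun a b ha hab hb haτ hbτ hQ ↦ ?_⟩
  have hsub : Icc a b ⊆ Icc 0 T := Icc_subset_Icc ha hb
  have h1 := D.velocity_mem_of_approx hab (hz.mono hsub)
    (fun t ht ↦ h t (hsub ht) (abs_sub_lt_of_mem_Icc haτ hbτ ht)) fun δ' hδ' ↦ by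
      obtain ⟨ε, hε, hεδ, u, hu, hu1, x, hx, hxz⟩ := happrox δ' hδ'
      exact ⟨ε, hε, hεδ, u, hu, hu1, x, hx.mono ha hab hb, fun t ht ↦ hxz t (hsub ht)⟩
  have hne : ∀ᵐ t : ℝ, t ≠ a := by simp [ae_iff, measure_singleton]
  filter_upwards [hQ, h1, hne] with t h₁ h₂ hta ht
  rcases lt_or_gt_of_ne hta with hlt | hgt
  · exact h₁ ⟨ht.1, hlt⟩
  · exact h₂ ⟨hgt, ht.2⟩

theorem isCompact_closure_and_isAverageSolution (hG : ∀ p, Nonempty (LocalModel G p)) {T : ℝ}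
    (hT : 0 < T) {K : Set M} {ε : ℕ → ℝ} {u : ℕ → ℝ → EuclideanSpace ℝ (Fin m)} {x : ℕ → ℝ → M}
    (hK : IsCompact K) (hε : ∀ k, 0 < ε k) (hε0 : Tendsto ε atTop (𝓝 0))
    (hu : ∀ k, AEStronglyMeasurable (u k) (volume.restrict (Icc 0 T)))
    (hu1 : ∀ k, ∀ᵐ t ∂volume.restrict (Icc 0 T), ‖u k t‖ ≤ 1)
    (hx : ∀ k, G.IsSolution (ε k) T (u k) (x k)) (hxK : ∀ k, ∀ t ∈ Icc 0 T, x k t ∈ K) :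
    ∃ X : ℕ → C(Icc (0 : ℝ) T, M), (∀ k t, X k t = x k t) ∧ IsCompact (closure (range X)) ∧
      ∀ z : C(Icc (0 : ℝ) T, M), MapClusterPt z atTop X →
        G.IsAverageSolution T (IccExtend hT.le z) := by
  choose u' hu' hu1' huu' using fun k ↦ exists_measurable_norm_le_one (hu k) (hu1 k)
  have hx' : ∀ k, IsTrajectory G (ε k) (u' k) (x k) 0 T := by
    intro k
    obtain ⟨hac, hd⟩ := (isSolution_iff G (ε k) T _ (x k)).1 (hx k)
    have hae := huu' k
    rw [EventuallyEq, ae_restrict_iff' measurableSet_Icc] at hae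
    refine ⟨hac, ?_⟩
    filter_upwards [hd, hae] with t h₁ h₂ ht
    rw [← h₂ ⟨ht.1.le, ht.2.le⟩]
    exact h₁ ht
  obtain ⟨Λ, hΛ⟩ := exists_lipschitzOnWith_of_isCompact hG hK hT.le
  have hlip : ∀ k, LipschitzOnWith Λ (x k) (Icc 0 T) := fun k ↦
    hΛ (ε k) (u' k) (x k) (hu1' k) (hx' k) (hxK k)
  let X : ℕ → C(Icc (0 : ℝ) T, M) := fun k ↦
    ⟨(Icc 0 T).domRestrict (x k), (hlip k).to_restrict.continuous⟩
  let S : Set C(Icc (0 : ℝ) T, M) := {f | LipschitzWith Λ f ∧ ∀ t, f t ∈ K}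
  have hS : IsCompact S := isCompact_setOf_lipschitzWith Λ hK
  have hXS : closure (range X) ⊆ S := closure_minimal
    (range_subset_iff.2 fun k ↦ ⟨(hlip k).to_restrict, fun t ↦ hxK k t t.2⟩) hS.isClosed
  refine ⟨X, fun _ _ ↦ rfl, hS.of_isClosed_subset isClosed_closure hXS, fun z hz ↦ ?_⟩
  have hzS : z ∈ S := hXS (mem_closure_iff_nhds.2 fun s hs ↦ by
    obtain ⟨k, hk⟩ := (hz.frequently hs).exists
    exact ⟨X k, hk, mem_range_self k⟩)
  have hzlip : LipschitzWith Λ (IccExtend hT.le z) := by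
    have := hzS.1.comp (LipschitzWith.projIcc hT.le)
    rwa [mul_one] at this
  refine (isAverageSolution_iff G T _).2 (isAverageTrajectory_of_approx hG hT.le
    hzlip.lipschitzOnWith fun δ hδ ↦ ?_)
  obtain ⟨k, hk, hkδ⟩ := ((hz.frequently (Metric.ball_mem_nhds z hδ)).and_eventually
    (hε0.eventually_lt_const hδ)).exists
  refine ⟨ε k, hε k, hkδ, u' k, hu' k, hu1' k, x k, hx' k, fun t ht ↦ ?_⟩
  rw [IccExtend_of_mem hT.le z ht]
  exact (ContinuousMap.dist_apply_le_dist (f := X k) (g := z) ⟨t, ht⟩).trans_lt hk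

end

end FastOscillation

theorem theorem3p7 (m n : ℕ) (M : Type*) [MetricSpace M] [ConnectedSpace M]
    [ChartedSpace (EuclideanSpace ℝ (Fin n)) M] [IsManifold (𝓡 n) ∞ M]
    [RiemannianBundle (fun x : M => TangentSpace (𝓡 n) x)]
    [IsContMDiffRiemannianBundle (𝓡 n) ∞ (EuclideanSpace ℝ (Fin n))
      (fun x : M => TangentSpace (𝓡 n) x)]
    [IsRiemannianManifold (𝓡 n) M]
    (G : OscillatingFields m n M) (T : ℝ) (hT : 0 < T) :
    -- approximation of every average solution, with an error of uniform order `ε`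
    (∀ x₀ : ℝ → M, G.IsAverageSolution T x₀ →
      ∃ (u : ℝ → ℝ → EuclideanSpace ℝ (Fin m)) (c ε₀ : ℝ), 0 < c ∧ 0 < ε₀ ∧
        (∀ ε, 0 < ε → Measurable (u ε) ∧ ∀ t, ‖u ε t‖ ≤ 1) ∧
        ∀ ε, 0 < ε → ε < ε₀ →
          ∃ x : ℝ → M, G.IsSolution ε T (u ε) x ∧ x 0 = x₀ 0 ∧
            (∀ y : ℝ → M, G.IsSolution ε T (u ε) y → y 0 = x₀ 0 → EqOn y x (Icc 0 T)) ∧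
            ∀ t ∈ Icc 0 T, dist (x t) (x₀ t) < c * ε) ∧
    -- compactness of the solutions of the oscillating systems, and their accumulation points
    (∀ (K : Set M) (ε : ℕ → ℝ) (u : ℕ → ℝ → EuclideanSpace ℝ (Fin m)) (x : ℕ → ℝ → M),
      IsCompact K → Antitone ε → (∀ k, 0 < ε k) → Tendsto ε atTop (𝓝 0) →
      (∀ k, AEStronglyMeasurable (u k) (volume.restrict (Icc 0 T))) →
      (∀ k, ∀ᵐ t ∂volume.restrict (Icc 0 T), ‖u k t‖ ≤ 1) →
      (∀ k, G.IsSolution (ε k) T (u k) (x k)) →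
      (∀ k, ∀ t ∈ Icc 0 T, x k t ∈ K) →
      ∃ X : ℕ → C(Icc (0 : ℝ) T, M), (∀ k t, X k t = x k t) ∧
        IsCompact (closure (range X)) ∧
        ∀ z : C(Icc (0 : ℝ) T, M), MapClusterPt z atTop X →
          G.IsAverageSolution T (IccExtend hT.le z)) := by
  have := FastOscillation.isContinuousRiemannianBundle (n := n) (M := M)
  have hG := FastOscillation.nonempty_localModel G
  exact ⟨fun x₀ h ↦ FastOscillation.exists_controls_approximating hG hT h,
    fun _ _ _ _ hK _ hε hε0 hu hu1 hx hxK ↦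
      FastOscillation.isCompact_closure_and_isAverageSolution hG hT hK hε hε0 hu hu1 hx hxK⟩
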